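/- Let $q$ be an odd prime power with $q\equiv 3\pmod{10}$ and put $n=\frac{q^2+1}{10}$, $r=q+1$, $s=\frac{q^2+1}{2}$. Let $\lambda$ be an integer with $1\le\lambda\le\frac{q-3}{10}$. Let $\alpha\in\mathbb F_{q^2}^{*}$ be a primitive $r$-th root of unity and let $\delta$, in an extension field of $\mathbb F_{q^2}$, be a primitive $rn$-th root of unity with $\delta^n=\alpha$. An $\alpha$-constacyclic code $\mathcal C\subseteq\mathbb F_{q^2}^n$ is a linear code closed under $(c_0,\dots,c_{n-1})\mapsto(\alpha c_{n-1},c_0,\dots,c_{n-2})$; it corresponds to an ideal $\langle g\rangle$ of $\mathbb F_{q^2}[x]/\langle x^n-\alpha\rangle$ with $g$ monic, $g\mid x^n-\alpha$, and its defining set is $\{i\in\{1+rj: 0\le j\le n-1\} : g(\delta^i)=0\}$, read modulo $rn$. Let $C_i=\{iq^{2j}\bmod rn : j\ge 0\}$ be the $q^2$-cyclotomic coset of $i$ modulo $rn$, and let $$T=\bigcup_{j=0}^{\frac{4(q-3)}{10}+\lambda} C_{s-rj}.$$ Then there is an $\alpha$-constacyclic code of length $n$ over $\mathbb F_{q^2}$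 with defining set $T$, and if $\mathcal C$ is such a code, then there exists an entanglement-assisted quantum code with parameters $$[[\,n,\;k,\;d;\;9\,]]_q,\qquad k=n-\tfrac85(q-3)-4\lambda+7,\qquad d=\tfrac45(q-3)+2\lambda+2,$$ and these parameters satisfy $n+9-k=2(d-1)$, i.e. equality in the entanglement-assisted Singleton bound $n+c-k\ge 2(d-1)$, as well as, if $q\ne 13$, the inequality $d\le\frac{n+2}{2}$ (so that the code is an EAQMDS code). Here an entanglement-assisted code $[[n,k,d;c]]_q$, $k\ge1$, is given by an isometry $V:(\mathbb C^q)^{\otimes k}\otimes(\mathbb C^q)^{\otimes c}\to(\mathbb C^q)^{\otimes n}$. A state $\varphi$ of $k$ logical $q$-level systems is encoded as $(V\otimes I)(\varphi\otimes\Phi)$, where $\Phi=q^{-c/2}\sum_a|a\rangle|a\rangle$ is the state of $c$ maximally entangled pairs, whose second halves stay with the receiver and are free of errors. An error $E$ on the $n$ transmitted systems is detected if $P(E\otimes I)P=\mu P$ for some scalar $\mu$, where $P$ is the projection onto the space of encoded states. The code has minimum distance $d$ if every error acting on fewer than $d$ of the $n$ systems is detected and some error acting on $d$ of them is not. -/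

import Mathlib

open Polynomial

/-! ### Constacyclic codes -/

/-- The `α`-constacyclic shift `(c₀, …, c_{n-1}) ↦ (α c_{n-1}, c₀, …, c_{n-2})`. -/
def constacyclicShift {F : Type*} [Field F] {n : ℕ} (α : F) (c : Fin n → F) : Fin n → F :=
  fun i => if (i : ℕ) = 0 then α * c ⟨n - 1, by have := i.isLt; omega⟩
    else c ⟨(i : ℕ) - 1, by have := i.isLt; omega⟩

/-- A linear code of length `n` over `F` that is closed under the `α`-constacyclic shift. -/
def IsConstacyclic {F : Type*} [Field F] {n : ℕ} (α : F) (𝒞 : Submodule F (Fin n → F)) : Prop :=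
  ∀ c ∈ 𝒞, constacyclicShift α c ∈ 𝒞

/-- The polynomial `c₀ + c₁ x + ⋯ + c_{n-1} x^{n-1}` of a word. -/
noncomputable def wordPoly {F : Type*} [Field F] {n : ℕ} (c : Fin n → F) : F[X] :=
  ∑ i : Fin n, C (c i) * X ^ (i : ℕ)

/-- `g` is the generator polynomial of `𝒞`: a monic divisor of `x ^ n - α` such that `𝒞`
corresponds to the ideal `⟨g⟩` of `F[x] / ⟨x ^ n - α⟩`. (As `g ∣ x ^ n - α`, the class of a
polynomial lies in that ideal exactly when `g` divides the polynomial.) -/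
def IsGeneratorPoly {F : Type*} [Field F] {n : ℕ} (α : F) (𝒞 : Submodule F (Fin n → F))
    (g : F[X]) : Prop :=
  g.Monic ∧ g ∣ X ^ n - C α ∧ ∀ c : Fin n → F, c ∈ 𝒞 ↔ g ∣ wordPoly c

/-- The set `𝒪_{rn} = {1 + r j | 0 ≤ j ≤ n - 1}` of residues modulo `r n`. -/
def rootExponents (r n : ℕ) : Set (ZMod (r * n)) :=
  {i | ∃ j : ℕ, j < n ∧ i = 1 + (r : ZMod (r * n)) * (j : ZMod (r * n))}

/-- The defining set `{i ∈ 𝒪_{rn} | δ ^ i is a root of g}`, where `δ` is a primitive `rn`-th root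
of unity in an extension field `K` of `F`. -/
def definingSet {F K : Type*} [Field F] [Field K] [Algebra F K] (r n : ℕ) (δ : K) (g : F[X]) :
    Set (ZMod (r * n)) :=
  {i | i ∈ rootExponents r n ∧ aeval (δ ^ i.val) g = 0}

/-- `𝒞` is an `α`-constacyclic code of length `n` whose defining set (with respect to `δ`)
is `T`. -/
def IsConstacyclicWithDefiningSet {F K : Type*} [Field F] [Field K] [Algebra F K] (r n : ℕ)
    (α : F) (δ : K) (𝒞 : Submodule F (Fin n → F)) (T : Set (ZMod (r * n))) : Prop :=
  IsConstacyclic α 𝒞 ∧ ∃ g : F[X], IsGeneratorPoly α 𝒞 g ∧ definingSet r n δ g = T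

/-- The `Q`-cyclotomic coset of `i` modulo `N` (here `Q` is prime to `N`, so that nonnegative
exponents suffice). -/
def cyclotomicCoset (Q N : ℕ) (i : ZMod N) : Set (ZMod N) :=
  {x | ∃ j : ℕ, x = i * (Q : ZMod N) ^ j}

/-! ### Entanglement-assisted quantum codes

The state space of `m` qudits with level set `A` is the space of functions `(Fin m → A) → ℂ`,
the standard basis being indexed by the words `Fin m → A`. -/

/-- The state of `c` maximally entangled pairs of qudits, the sender's halves listed first:
`|A|^{-c/2} ∑ₐ |a⟩|a⟩`. -/
noncomputable def maxEntangled (A : Type*) [Fintype A] [DecidableEq A] (c : ℕ)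
    (a b : Fin c → A) : ℂ :=
  if a = b then ((1 / Real.sqrt ((Fintype.card A : ℝ) ^ c) : ℝ) : ℂ) else 0

/-- The encoded state of `φ`, a state of `k` logical qudits. The sender applies `V` to the logical
qudits and to her halves of `c` maximally entangled pairs; the result consists of the `n` qudits
sent through the channel and the `c` qudits that the receiver holds. -/
noncomputable def eaEncode {A : Type*} [Fintype A] [DecidableEq A] {n k c : ℕ}
    (V : Matrix (Fin n → A) ((Fin k → A) × (Fin c → A)) ℂ) (φ : (Fin k → A) → ℂ) :
    (Fin n → A) × (Fin c → A) → ℂ :=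
  fun p => ∑ l : Fin k → A, ∑ a : Fin c → A, V p.1 (l, a) * (φ l * maxEntangled A c a p.2)

/-- The operator `E` on `n` qudits acts as the identity on all qudits outside `S`,
that is, `E = M ⊗ 1` for an operator `M` on the qudits in `S`. -/
def ActsOn {A : Type*} {n : ℕ} (S : Finset (Fin n))
    (E : Matrix (Fin n → A) (Fin n → A) ℂ) : Prop :=
  ∃ M : Matrix (S → A) (S → A) ℂ,
    (∀ x y : Fin n → A, (∀ i, i ∉ S → x i = y i) →
      E x y = M (fun i => x i) (fun i => y i)) ∧
    (∀ x y : Fin n → A, ¬ (∀ i, i ∉ S → x i = y i) → E x y = 0)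

/-- The error `E ⊗ 1` on the joint system, `E` acting on the `n` transmitted qudits and the
receiver's `c` qudits being free of errors. -/
noncomputable def applyError {A : Type*} [Fintype A] {n c : ℕ}
    (E : Matrix (Fin n → A) (Fin n → A) ℂ) (ψ : (Fin n → A) × (Fin c → A) → ℂ) :
    (Fin n → A) × (Fin c → A) → ℂ :=
  fun p => ∑ y : Fin n → A, E p.1 y * ψ (y, p.2)

/-- The Knill–Laflamme condition for the detection of `E`: `P (E ⊗ 1) P = μ P` for some scalar `μ`,
where `P` is the projection onto the space of encoded states. -/
def Detects {A : Type*} [Fintype A] [DecidableEq A] {n k c : ℕ}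
    (V : Matrix (Fin n → A) ((Fin k → A) × (Fin c → A)) ℂ)
    (E : Matrix (Fin n → A) (Fin n → A) ℂ) : Prop :=
  ∃ μ : ℂ, ∀ φ ψ : (Fin k → A) → ℂ,
    star (eaEncode V φ) ⬝ᵥ applyError E (eaEncode V ψ) =
      μ * (star (eaEncode V φ) ⬝ᵥ eaEncode V ψ)

/-- `V` is the encoder of an entanglement-assisted quantum code `[[n, k, d; c]]` (`k ≥ 1`) on qudits
with level set `A`: it is an isometry (a unitary operator on `n` qudits, `n - k - c` of which are
ancillas in a fixed state), every error on fewer than `d` of the transmitted qudits is detected,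
and some error on `d` of them is not. -/
def IsEAQECC {A : Type*} [Fintype A] [DecidableEq A] (n k d c : ℕ)
    (V : Matrix (Fin n → A) ((Fin k → A) × (Fin c → A)) ℂ) : Prop :=
  V.conjTranspose * V = 1 ∧
  (∀ (S : Finset (Fin n)) (E : Matrix (Fin n → A) (Fin n → A) ℂ),
    S.card < d → ActsOn S E → Detects V E) ∧
  (∃ (S : Finset (Fin n)) (E : Matrix (Fin n → A) (Fin n → A) ℂ),
    S.card = d ∧ ActsOn S E ∧ ¬ Detects V E)

/-- There is an entanglement-assisted quantum code `[[n, k, d; c]]_q`: it encodes `k ≥ 1` logical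
`q`-level systems into `n` with the help of `c` maximally entangled pairs, and its minimum distance
is `d`. -/
def ExistsEAQECC (q n k d c : ℕ) : Prop :=
  1 ≤ k ∧ ∃ V : Matrix (Fin n → Fin q) ((Fin k → Fin q) × (Fin c → Fin q)) ℂ,
    IsEAQECC n k d c V

/-! Write q = 10t + 3, so n = 10t² + 6t + 1, put m = 4t + λ ≤ 5t, and let β = δ^(q+1), a primitive
n-th root of unity. Since s = 5n and δ^n = α, rescaling coordinate i by α^(5i), a Hermitian isometry
because α^(q+1) = 1, turns a code with defining set T into the cyclic code with zeros β^j, |j| ≤ m.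
The proof works directly with this cyclic model: S is the code over F = 𝔽_{q²} of words with Fourier
support in [-m, m], and D is its Hermitian dual.

Because n ∣ q² + 1, the q²-Frobenius inverts β and hence preserves the interval [-m, m]. A
Vandermonde argument then shows that any 2m + 1 positions form an information set of S
(`exists_isSystematic_fourierCode`). So S has dimension 2m + 1, it takes all values on any fewer
than d = 2m + 2 positions, and D contains words of weight at most d outside S.

A pair (S, D) gives a quantum code as follows. Gram–Schmidt yields anisotropic orthogonal families u
in S and w in D that span complements of the common radical S ⊓ D. Real and imaginary parts over 𝔽_q
turn the Hermitian form into the symplectic form that governs commutation of Weyl operators. The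
radical together with ε times the 𝔽_q-span of u and w is isotropic and stabilizes a vector v. Weyl
shifts along w label the logical states, shifts along u label the sender's halves of the entangled
pairs. Weyl operators of S only permute the latter labels, up to phases, so averaging over them
leaves the partially traced error unchanged. The same average turns an error on fewer than d
positions into a scalar, since S is onto there; hence the error is detected
(`exists_isEAQECC_of_isotropic`). A word of D outside S acts as a nontrivial logical shift and is
not detected.

The number c of pairs is the rank of the Hermitian form on S. Frequencies a and b pair nontrivially
exactly when n ∣ qa + b, so c counts the a in [-m, m] with a partner b in [-m, m]
(`card_orthogonal_family_fourierCode`). This is a lattice point count in a square, and the answer is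
9 (`card_selfPairedFreq`). Dimensions then give k = n + c - 4m - 2.

Existence of the constacyclic code is separate: T is closed under multiplication by q², so the
product of the X - δ^i over i in T descends to F. -/

open scoped Matrix

/-! ### Weyl operators -/

/-- The standard symplectic form on `Aⁿ × Aⁿ`. -/
def sympForm {A : Type*} [Field A] {n : ℕ} (z w : (Fin n → A) × (Fin n → A)) : A :=
  ∑ i, (z.2 i * w.1 i - z.1 i * w.2 i)

section symp

variable {A : Type*} [Field A] {n : ℕ} (x y z : (Fin n → A) × (Fin n → A))

lemma sympForm_add_left : sympForm (x + y) z = sympForm x z + sympForm y z := by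
  simp only [sympForm, ← Finset.sum_add_distrib]
  exact Finset.sum_congr rfl fun i _ => by
    simp only [Prod.snd_add, Prod.fst_add, Pi.add_apply]; ring

lemma sympForm_swap : sympForm x y = -sympForm y x := by
  simp only [sympForm, ← Finset.sum_neg_distrib]
  exact Finset.sum_congr rfl fun i _ => by ring

lemma sympForm_add_right : sympForm x (y + z) = sympForm x y + sympForm x z := by
  rw [sympForm_swap, sympForm_add_left, sympForm_swap y, sympForm_swap z]; ring

lemma sympForm_smul_left (c : A) : sympForm (c • x) y = c * sympForm x y := by
  simp only [sympForm, Finset.mul_sum]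
  exact Finset.sum_congr rfl fun i _ => by
    simp only [Prod.smul_snd, Prod.smul_fst, Pi.smul_apply, smul_eq_mul]; ring

lemma sympForm_neg_left : sympForm (-x) y = -sympForm x y := by
  simpa using sympForm_smul_left x y (-1)

lemma sympForm_self : sympForm x x = 0 := by
  simp only [sympForm]
  exact Finset.sum_eq_zero fun i _ => by ring

end symp

/-- The Weyl operator of `(a, b) ∈ Aⁿ × Aⁿ`: it maps the basis vector `|v⟩` to
`χ (b ⬝ (v + a / 2)) |v + a⟩`. -/
noncomputable def weyl {A : Type*} [Field A] [DecidableEq A] {n : ℕ} (χ : AddChar A ℂ)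
    (z : (Fin n → A) × (Fin n → A)) : Matrix (Fin n → A) (Fin n → A) ℂ :=
  fun u v => if u = v + z.1 then χ (∑ i, z.2 i * (v i + z.1 i / 2)) else 0

section weyl

set_option linter.unusedSectionVars false

variable {A : Type*} [Field A] [Fintype A] [DecidableEq A] {n : ℕ} (χ : AddChar A ℂ)

/-- The half shift in the phase of `weyl` makes the cocycle antisymmetric. On an isotropic subspace
the operators therefore multiply with no phase at all; this is where odd characteristic enters. -/
lemma weyl_mul (h2 : (2 : A) ≠ 0) (z w : (Fin n → A) × (Fin n → A)) :
    weyl χ z * weyl χ w = χ (sympForm z w / 2) • weyl χ (z + w) := by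
  ext u v
  rw [Matrix.mul_apply, Finset.sum_eq_single (v + w.1)]
  · simp only [weyl, Matrix.smul_apply, smul_eq_mul, if_true, Prod.fst_add]
    have : v + w.1 + z.1 = v + (z.1 + w.1) := by abel
    rw [this]
    split_ifs with h
    · rw [← AddChar.map_add_eq_mul, ← AddChar.map_add_eq_mul]
      congr 1
      simp only [sympForm, Finset.sum_div, ← Finset.sum_add_distrib]
      refine Finset.sum_congr rfl fun i _ => ?_
      simp only [Prod.snd_add, Pi.add_apply]
      field_simp
      ring
    · simp
  · intro b _ hb
    simp [weyl, hb]
  · simp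

lemma weyl_zero : weyl χ (0 : (Fin n → A) × (Fin n → A)) = 1 := by
  ext u v
  simp [weyl, Matrix.one_apply]

lemma weyl_conjTranspose (h2 : (2 : A) ≠ 0) (z : (Fin n → A) × (Fin n → A)) :
    (weyl χ z)ᴴ = weyl χ (-z) := by
  ext u v
  simp only [weyl, Matrix.conjTranspose_apply, Prod.fst_neg, Prod.snd_neg]
  by_cases h : v = u + z.1
  · have h' : u = v + -z.1 := by rw [h]; abel
    rw [if_pos h, if_pos h']
    have := AddChar.map_neg_eq_conj χ (∑ i, z.2 i * (u i + z.1 i / 2))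
    rw [← starRingEnd_apply, ← this]
    congr 1
    rw [← Finset.sum_neg_distrib]
    refine Finset.sum_congr rfl fun i _ => ?_
    simp only [h, Pi.add_apply, Pi.neg_apply]
    field_simp
    ring
  · have h' : ¬ u = v + -z.1 := fun e => h (by rw [e]; abel)
    rw [if_neg h, if_neg h', star_zero]

lemma weyl_comm (h2 : (2 : A) ≠ 0) (z w : (Fin n → A) × (Fin n → A)) :
    weyl χ z * weyl χ w = χ (sympForm z w) • (weyl χ w * weyl χ z) := by
  rw [weyl_mul χ h2, weyl_mul χ h2, smul_smul, ← AddChar.map_add_eq_mul, add_comm w z,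
    sympForm_swap w z]
  congr 2
  field_simp
  ring

lemma star_addChar_mul_self (a : A) : star (χ a) * χ a = 1 := by
  rw [← starRingEnd_apply, ← AddChar.map_neg_eq_conj, ← AddChar.map_add_eq_mul]
  simp

lemma weyl_unitary (h2 : (2 : A) ≠ 0) (z : (Fin n → A) × (Fin n → A)) :
    (weyl χ z)ᴴ * weyl χ z = 1 := by
  rw [weyl_conjTranspose χ h2, weyl_mul χ h2, sympForm_neg_left, sympForm_self]
  simp [weyl_zero]

/-- Conjugating by a Weyl operator, entrywise. -/
lemma weyl_conj_apply (z : (Fin n → A) × (Fin n → A))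
    (E : Matrix (Fin n → A) (Fin n → A) ℂ) (u v : Fin n → A) :
    ((weyl χ z)ᴴ * E * weyl χ z) u v = χ (∑ i, z.2 i * (v i - u i)) * E (u + z.1) (v + z.1) := by
  rw [Matrix.mul_apply, Finset.sum_eq_single (v + z.1)]
  · rw [Matrix.mul_apply, Finset.sum_eq_single (u + z.1)]
    · simp only [weyl, Matrix.conjTranspose_apply, if_true]
      rw [← starRingEnd_apply, ← AddChar.map_neg_eq_conj, mul_right_comm,
        ← AddChar.map_add_eq_mul]
      congr 2
      rw [← Finset.sum_neg_distrib, ← Finset.sum_add_distrib]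
      exact Finset.sum_congr rfl fun i _ => by ring
    · intro b _ hb
      simp [weyl, Matrix.conjTranspose_apply, hb]
    · simp
  · intro b _ hb
    simp [weyl, hb]
  · simp

open scoped ComplexOrder in
/-- The operators of an isotropic subspace have a common fixed unit vector. -/
lemma exists_unit_fixed (h2 : (2 : A) ≠ 0) (M : Submodule A ((Fin n → A) × (Fin n → A)))
    (hM : ∀ x ∈ M, ∀ y ∈ M, sympForm x y = 0) :
    ∃ v : (Fin n → A) → ℂ, star v ⬝ᵥ v = 1 ∧ ∀ x ∈ M, weyl χ x *ᵥ v = v := by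
  classical
  -- The orbit sum of |0⟩ under M is fixed by M. It is nonzero because its coefficient at 0 counts
  -- the elements of M with zero shift part, each of which contributes phase 1.
  set w : (Fin n → A) → ℂ := ∑ m : M, weyl χ (m : (Fin n → A) × (Fin n → A)) *ᵥ Pi.single 0 1
    with hw
  have hfix : ∀ x ∈ M, weyl χ x *ᵥ w = w := by
    intro x hx
    rw [hw, Matrix.mulVec_sum]
    refine Fintype.sum_equiv (Equiv.addLeft (⟨x, hx⟩ : M)) _ _ fun m => ?_
    rw [Matrix.mulVec_mulVec, weyl_mul χ h2, hM x hx m m.2]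
    simp
  have h0 : w 0 ≠ 0 := by
    have : w 0 = ((Finset.univ.filter fun m : M =>
        (m : (Fin n → A) × (Fin n → A)).1 = 0).card : ℂ) := by
      rw [hw, Finset.sum_apply, Finset.card_filter, Nat.cast_sum]
      refine Finset.sum_congr rfl fun m _ => ?_
      simp only [Matrix.mulVec_single_one, Matrix.col_apply, weyl, zero_add,
        eq_comm (a := (0 : Fin n → A))]
      split_ifs with h
      · simp [h]
      · simp
    rw [this, Nat.cast_ne_zero, ← Nat.pos_iff_ne_zero, Finset.card_pos]
    exact ⟨0, by simp⟩
  have hpos : 0 < star w ⬝ᵥ w := Matrix.dotProduct_star_self_pos_iff.2 fun h => h0 (by rw [h]; rfl)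
  obtain ⟨r, hr, hrw⟩ : ∃ r : ℝ, 0 < r ∧ star w ⬝ᵥ w = r := by
    rw [Complex.lt_def] at hpos
    exact ⟨(star w ⬝ᵥ w).re, hpos.1, Complex.ext rfl (by simpa using hpos.2.symm)⟩
  refine ⟨((1 / Real.sqrt r : ℝ) : ℂ) • w, ?_, fun x hx => by rw [Matrix.mulVec_smul, hfix x hx]⟩
  rw [star_smul, smul_dotProduct, dotProduct_smul, hrw, smul_eq_mul, smul_eq_mul,
    ← starRingEnd_apply, Complex.conj_ofReal, ← Complex.ofReal_mul, ← Complex.ofReal_mul]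
  rw [← Complex.ofReal_one]
  congr 1
  have := Real.mul_self_sqrt hr.le
  have h3 : Real.sqrt r ≠ 0 := (Real.sqrt_pos.2 hr).ne'
  field_simp
  nlinarith

end weyl

/-! ### The detection condition as a partial trace -/

section detect

variable {A : Type*} [Fintype A] [DecidableEq A] {n k c : ℕ}
  (V : Matrix (Fin n → A) ((Fin k → A) × (Fin c → A)) ℂ)

/-- The partial trace of `Vᴴ * E * V` over the sender's halves of the entangled pairs. -/
noncomputable def partialTrace (E : Matrix (Fin n → A) (Fin n → A) ℂ) (l l' : Fin k → A) : ℂ :=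
  ∑ a : Fin c → A, star (fun p => V p (l, a)) ⬝ᵥ (E *ᵥ fun p => V p (l', a))

lemma eaEncode_apply (φ : (Fin k → A) → ℂ) (p : (Fin n → A) × (Fin c → A)) :
    eaEncode V φ p =
      ((1 / Real.sqrt ((Fintype.card A : ℝ) ^ c) : ℝ) : ℂ) * ∑ l, φ l * V p.1 (l, p.2) := by
  simp only [eaEncode, maxEntangled, mul_ite, mul_zero, Finset.sum_ite_eq', Finset.mem_univ,
    if_true, Finset.mul_sum]
  exact Finset.sum_congr rfl fun l _ => by ring

lemma inner_eaEncode (E : Matrix (Fin n → A) (Fin n → A) ℂ) (φ ψ : (Fin k → A) → ℂ) :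
    star (eaEncode V φ) ⬝ᵥ applyError E (eaEncode V ψ) =
      ((1 / Real.sqrt ((Fintype.card A : ℝ) ^ c) : ℝ) : ℂ) ^ 2 *
        ∑ l, ∑ l', star (φ l) * ψ l' * partialTrace V E l l' := by
  set r : ℂ := ((1 / Real.sqrt ((Fintype.card A : ℝ) ^ c) : ℝ) : ℂ) with hr
  have hrs : star r = r := by rw [← starRingEnd_apply, hr, Complex.conj_ofReal]
  have h1 : ∀ (b : Fin c → A), ∑ p : Fin n → A, star (eaEncode V φ (p, b)) *
      applyError E (eaEncode V ψ) (p, b) = r ^ 2 * ∑ l, ∑ l', star (φ l) * ψ l' *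
        (star (fun p => V p (l, b)) ⬝ᵥ (E *ᵥ fun p => V p (l', b))) := by
    intro b
    have h2 : (fun p => eaEncode V φ (p, b)) = r • ∑ l, φ l • (fun p => V p (l, b)) := by
      ext p; simp [eaEncode_apply, hr, Finset.sum_apply]
    have h3 : (fun p => applyError E (eaEncode V ψ) (p, b)) =
        E *ᵥ (r • ∑ l, ψ l • (fun p => V p (l, b))) := by
      have h2' : (fun p => eaEncode V ψ (p, b)) = r • ∑ l, ψ l • (fun p => V p (l, b)) := by
        ext p; simp [eaEncode_apply, hr, Finset.sum_apply]
      rw [← h2']; rfl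
    change star (fun p => eaEncode V φ (p, b)) ⬝ᵥ
      (fun p => applyError E (eaEncode V ψ) (p, b)) = _
    rw [h2, h3, Matrix.mulVec_smul, Matrix.mulVec_sum, star_smul, smul_dotProduct,
      dotProduct_smul, star_sum, sum_dotProduct, hrs, smul_eq_mul, smul_eq_mul, ← mul_assoc, sq]
    congr 1
    refine Finset.sum_congr rfl fun l _ => ?_
    rw [dotProduct_sum]
    refine Finset.sum_congr rfl fun l' _ => ?_
    rw [Matrix.mulVec_smul, star_smul, smul_dotProduct, dotProduct_smul, smul_eq_mul, smul_eq_mul]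
    ring
  simp only [dotProduct, Fintype.sum_prod_type_right, Pi.star_apply]
  rw [Finset.sum_congr rfl fun b _ => h1 b, ← Finset.mul_sum, Finset.sum_comm]
  congr 1
  refine Finset.sum_congr rfl fun l _ => ?_
  rw [Finset.sum_comm]
  refine Finset.sum_congr rfl fun l' _ => ?_
  rw [partialTrace, Finset.mul_sum]

lemma applyError_one (ψ : (Fin n → A) × (Fin c → A) → ℂ) : applyError 1 ψ = ψ := by
  ext p
  simp [applyError, Matrix.one_apply]

/-- The receiver's halves are untouched, so the maximally entangled state traces out the label a,
and sesquilinearity reduces the condition to basis states l, l'. -/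
lemma detects_iff [Nonempty A] (E : Matrix (Fin n → A) (Fin n → A) ℂ) :
    Detects V E ↔ ∃ μ : ℂ, ∀ l l', partialTrace V E l l' = μ * partialTrace V 1 l l' := by
  have hr : ((1 / Real.sqrt ((Fintype.card A : ℝ) ^ c) : ℝ) : ℂ) ^ 2 ≠ 0 := by
    have : (0 : ℝ) < (Fintype.card A : ℝ) ^ c := by
      have : 0 < Fintype.card A := Fintype.card_pos
      positivity
    have := (Real.sqrt_pos.2 this).ne'
    refine pow_ne_zero 2 (Complex.ofReal_ne_zero.2 (by positivity))
  constructor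
  · rintro ⟨μ, h⟩
    refine ⟨μ, fun l l' => ?_⟩
    have := h (Pi.single l 1) (Pi.single l' 1)
    rw [← applyError_one (eaEncode V (Pi.single l' 1)), inner_eaEncode, applyError_one,
      inner_eaEncode, mul_left_comm] at this
    have := mul_left_cancel₀ hr this
    have h4 : ∀ G : (Fin k → A) → (Fin k → A) → ℂ, (∑ i, ∑ j,
        star ((Pi.single l 1 : (Fin k → A) → ℂ) i) * (Pi.single l' 1 : (Fin k → A) → ℂ) j * G i j)
        = G l l' := by
      intro G
      rw [Finset.sum_eq_single l, Finset.sum_eq_single l']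
      · simp
      · intro b _ hb; simp [hb]
      · simp
      · intro b _ hb; simp [hb]
      · simp
    rwa [h4, h4] at this
  · rintro ⟨μ, h⟩
    refine ⟨μ, fun φ ψ => ?_⟩
    conv_rhs => rw [← applyError_one (eaEncode V ψ)]
    rw [inner_eaEncode, inner_eaEncode, mul_left_comm]
    congr 1
    simp only [Finset.mul_sum, h]
    exact Finset.sum_congr rfl fun l _ => Finset.sum_congr rfl fun l' _ => by ring

end detect

/-! ### Codes from isotropic data -/

section core

set_option linter.unusedSectionVars false

variable {A : Type*} [Field A] [Fintype A] [DecidableEq A] {n : ℕ} (χ : AddChar A ℂ)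

lemma star_dotProduct_mulVec {m : Type*} [Fintype m] (P E : Matrix m m ℂ) (v w : m → ℂ) :
    star (P *ᵥ v) ⬝ᵥ (E *ᵥ (P *ᵥ w)) = star v ⬝ᵥ ((Pᴴ * E * P) *ᵥ w) := by
  rw [Matrix.star_mulVec, ← Matrix.dotProduct_mulVec, Matrix.mulVec_mulVec, Matrix.mulVec_mulVec]

/-- Averaging an operator on the qudits in `T` over Weyl operators that induce all of
`(A × A)^T` gives a scalar. -/
lemma twirl_eq_smul_one (hχ : χ.IsPrimitive) (S : AddSubgroup ((Fin n → A) × (Fin n → A)))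
    (T : Finset (Fin n))
    (hS : ∀ z : (Fin n → A) × (Fin n → A), ∃ s ∈ S, ∀ i ∈ T, s.1 i = z.1 i ∧ s.2 i = z.2 i)
    (E : Matrix (Fin n → A) (Fin n → A) ℂ) (hE : ActsOn T E) :
    ∃ μ : ℂ, ∑ᶠ s : S, (weyl χ (s : (Fin n → A) × (Fin n → A)))ᴴ * E * weyl χ s = μ • 1 := by
  classical
  simp only [finsum_eq_sum_of_fintype]
  obtain ⟨M, hM1, hM2⟩ := hE
  refine ⟨∑ s : S, E (0 + (s : (Fin n → A) × (Fin n → A)).1)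
    (0 + (s : (Fin n → A) × (Fin n → A)).1), ?_⟩
  ext u v
  simp only [Matrix.sum_apply, weyl_conj_apply, Matrix.smul_apply, smul_eq_mul]
  by_cases huv : u = v
  · subst huv
    rw [Matrix.one_apply_eq, mul_one]
    -- On T, translating the summation index by an element with shift part u moves the diagonal
    -- entry at 0 to the one at u, so all diagonal sums agree.
    obtain ⟨s0, hs0, hs0'⟩ := hS (u, 0)
    refine Fintype.sum_equiv (Equiv.addLeft (⟨s0, hs0⟩ : S)) _ _ fun s => ?_
    simp only [sub_self, mul_zero, Finset.sum_const_zero, AddChar.map_zero_eq_one, one_mul,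
      Equiv.coe_addLeft, zero_add]
    rw [hM1 _ _ fun _ _ => rfl, hM1 _ _ fun _ _ => rfl]
    have : (fun i : T => (u + (s : (Fin n → A) × (Fin n → A)).1) i) =
        fun i : T => (((⟨s0, hs0⟩ + s : S) : (Fin n → A) × (Fin n → A)).1) i := by
      funext i
      have := (hs0' i i.2).1
      simp only [AddSubgroup.coe_add, Prod.fst_add, Pi.add_apply, this]
    rw [this]
  · rw [Matrix.one_apply_ne huv, mul_zero]
    by_cases hT : ∀ i, i ∉ T → u i = v i
    · obtain ⟨i, hi⟩ : ∃ i, u i ≠ v i := by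
        by_contra! h
        exact huv (funext h)
      have hiT : i ∈ T := by
        by_contra h
        exact hi (hT i h)
      -- A pure phase operator at position i, available in S up to positions outside T, multiplies
      -- the off-diagonal sum by a factor different from 1, which forces the sum to vanish.
      obtain ⟨c, hc⟩ : ∃ c : A, χ (c * (v i - u i)) ≠ 1 := by
        have := hχ (sub_ne_zero.2 (Ne.symm hi))
        rw [AddChar.ne_one_iff] at this
        obtain ⟨c, hc⟩ := this
        exact ⟨c, by rwa [AddChar.mulShift_apply, mul_comm] at hc⟩
      obtain ⟨s0, hs0, hs0'⟩ := hS (0, Pi.single i c)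
      set f : S → ℂ := fun s => χ (∑ i, (s : (Fin n → A) × (Fin n → A)).2 i * (v i - u i)) *
        E (u + (s : (Fin n → A) × (Fin n → A)).1) (v + (s : (Fin n → A) × (Fin n → A)).1) with hf
      change ∑ s, f s = 0
      have hshift : ∀ s, f (⟨s0, hs0⟩ + s) = χ (c * (v i - u i)) * f s := by
        intro s
        have h1 : ∑ j, ((⟨s0, hs0⟩ + s : S) : (Fin n → A) × (Fin n → A)).2 j * (v j - u j) =
            c * (v i - u i) + ∑ j, (s : (Fin n → A) × (Fin n → A)).2 j * (v j - u j) := by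
          simp only [AddSubgroup.coe_add, Prod.snd_add, Pi.add_apply, add_mul,
            Finset.sum_add_distrib]
          congr 1
          rw [Finset.sum_eq_single i]
          · rw [(hs0' i hiT).2]; simp
          · intro j _ hj
            by_cases hjT : j ∈ T
            · rw [(hs0' j hjT).2]; simp [hj]
            · rw [hT j hjT]; simp
          · simp
        have h2 : ∀ s : S, E (u + (s : (Fin n → A) × (Fin n → A)).1)
            (v + (s : (Fin n → A) × (Fin n → A)).1) =
            M (fun i => u i + (s : (Fin n → A) × (Fin n → A)).1 i)
              (fun i => v i + (s : (Fin n → A) × (Fin n → A)).1 i) := by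
          intro s
          rw [hM1]
          · rfl
          · intro j hj
            simp only [Pi.add_apply, hT j hj]
        have h3 : ∀ j : T, ((⟨s0, hs0⟩ + s : S) : (Fin n → A) × (Fin n → A)).1 j =
            (s : (Fin n → A) × (Fin n → A)).1 j := by
          intro j
          simp [AddSubgroup.coe_add, (hs0' j j.2).1]
        simp only [hf]
        rw [h1, AddChar.map_add_eq_mul, h2, h2, mul_assoc]
        simp only [h3]
      have hsum : ∑ s, f s = χ (c * (v i - u i)) * ∑ s, f s := by
        rw [Finset.mul_sum, ← Finset.sum_congr rfl fun s _ => hshift s]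
        exact (Fintype.sum_equiv (Equiv.addLeft (⟨s0, hs0⟩ : S)) _ _ fun s => rfl).symm
      have : (χ (c * (v i - u i)) - 1) * ∑ s, f s = 0 := by rw [sub_mul, ← hsum]; ring
      exact (mul_eq_zero.1 this).resolve_left (sub_ne_zero.2 hc)
    · refine Finset.sum_eq_zero fun s _ => ?_
      rw [hM2, mul_zero]
      intro h
      exact hT fun i hi => by simpa using h i hi

/-- W(x) fixes v, while it acts on W(y)v by a scalar different from 1: eigenvectors of a unitary for
distinct eigenvalues are orthogonal. -/
lemma inner_weyl_eq_zero (h2 : (2 : A) ≠ 0) {v : (Fin n → A) → ℂ}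
    {x y : (Fin n → A) × (Fin n → A)} (hx : weyl χ x *ᵥ v = v) (hxy : χ (sympForm x y) ≠ 1) :
    star v ⬝ᵥ (weyl χ y *ᵥ v) = 0 := by
  have h : star v ⬝ᵥ (weyl χ y *ᵥ v) = χ (sympForm x y) * (star v ⬝ᵥ (weyl χ y *ᵥ v)) := by
    calc star v ⬝ᵥ (weyl χ y *ᵥ v)
        = star v ⬝ᵥ (((weyl χ x)ᴴ * weyl χ x) *ᵥ (weyl χ y *ᵥ v)) := by
          rw [weyl_unitary χ h2, Matrix.one_mulVec]
      _ = star (weyl χ x *ᵥ v) ⬝ᵥ ((weyl χ x * weyl χ y) *ᵥ v) := by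
          rw [Matrix.star_mulVec, ← Matrix.dotProduct_mulVec, Matrix.mulVec_mulVec,
            Matrix.mulVec_mulVec, Matrix.mul_assoc]
      _ = χ (sympForm x y) * (star v ⬝ᵥ (weyl χ y *ᵥ v)) := by
          rw [hx, weyl_comm χ h2, Matrix.smul_mulVec, dotProduct_smul, smul_eq_mul,
            ← Matrix.mulVec_mulVec, hx]
  have : (χ (sympForm x y) - 1) * (star v ⬝ᵥ (weyl χ y *ᵥ v)) = 0 := by
    rw [sub_mul, ← h]; ring
  exact (mul_eq_zero.1 this).resolve_left (sub_ne_zero.2 hxy)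

lemma inner_weyl_weyl (h2 : (2 : A) ≠ 0) (v : (Fin n → A) → ℂ)
    (y z : (Fin n → A) × (Fin n → A)) :
    star (weyl χ y *ᵥ v) ⬝ᵥ (weyl χ z *ᵥ v) =
      χ (sympForm (-y) z / 2) * (star v ⬝ᵥ (weyl χ (-y + z) *ᵥ v)) := by
  rw [Matrix.star_mulVec, ← Matrix.dotProduct_mulVec, Matrix.mulVec_mulVec,
    weyl_conjTranspose χ h2, weyl_mul χ h2, Matrix.smul_mulVec, dotProduct_smul, smul_eq_mul]

lemma weyl_actsOn (T : Finset (Fin n)) (z : (Fin n → A) × (Fin n → A))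
    (hz : ∀ i, i ∉ T → z.1 i = 0 ∧ z.2 i = 0) : ActsOn T (weyl χ z) := by
  classical
  refine ⟨fun u v => if ∀ i : T, u i = v i + z.1 i then
    χ (∑ i : T, z.2 i * (v i + z.1 i / 2)) else 0, fun u v huv => ?_, fun u v huv => ?_⟩
  · have h1 : (u = v + z.1) ↔ ∀ i : T, u i = v i + z.1 i := by
      constructor
      · rintro rfl i; rfl
      · intro h
        funext i
        by_cases hi : i ∈ T
        · exact h ⟨i, hi⟩
        · simp [huv i hi, (hz i hi).1]
    have h3 : ∑ i, z.2 i * (v i + z.1 i / 2) = ∑ i : T, z.2 i * (v i + z.1 i / 2) := by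
      rw [Finset.sum_coe_sort T (fun i => z.2 i * (v i + z.1 i / 2))]
      refine (Finset.sum_subset (Finset.subset_univ T) fun i _ hi => ?_).symm
      rw [(hz i hi).2, zero_mul]
    simp only [weyl, h1, h3]
  · rw [weyl, if_neg]
    intro h
    refine huv fun i hi => ?_
    rw [h]
    simp [(hz i hi).1]

end core

/-! ### The encoder and the detection argument -/

section core

variable {A : Type*} [Field A] [Fintype A] [DecidableEq A] {n : ℕ} (χ : AddChar A ℂ)

/-- The encoder `|l⟩|a⟩ ↦ W (B l + U a) v`. -/
noncomputable def weylEncoder {k c : ℕ} (B : (Fin k → A) →ₗ[A] (Fin n → A) × (Fin n → A))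
    (U : (Fin c → A) →ₗ[A] (Fin n → A) × (Fin n → A)) (v : (Fin n → A) → ℂ) :
    Matrix (Fin n → A) ((Fin k → A) × (Fin c → A)) ℂ :=
  fun p x => (weyl χ (B x.1 + U x.2) *ᵥ v) p

variable {k c : ℕ} {B : (Fin k → A) →ₗ[A] (Fin n → A) × (Fin n → A)}
  {U : (Fin c → A) →ₗ[A] (Fin n → A) × (Fin n → A)} {v : (Fin n → A) → ℂ}
  {M : Submodule A ((Fin n → A) × (Fin n → A))}

/-- Two basis vectors differ by a shift along B + U. By `hnd` some element of M pairs nontrivially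
with a nonzero such shift, and a scalar multiple of it has commutation phase different from 1. -/
lemma weylEncoder_isometry (h2 : (2 : A) ≠ 0) (hχ : χ.IsPrimitive)
    (hBB : ∀ l l', sympForm (B l) (B l') = 0) (hUU : ∀ a a', sympForm (U a) (U a') = 0)
    (hBU : ∀ l a, sympForm (B l) (U a) = 0)
    (hnd : ∀ l a, (∀ x ∈ M, sympForm x (B l + U a) = 0) → l = 0 ∧ a = 0)
    (hv1 : star v ⬝ᵥ v = 1) (hv : ∀ x ∈ M, weyl χ x *ᵥ v = v) :
    (weylEncoder χ B U v)ᴴ * weylEncoder χ B U v = 1 := by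
  ext ⟨l, a⟩ ⟨l', a'⟩
  change star (weyl χ (B l + U a) *ᵥ v) ⬝ᵥ (weyl χ (B l' + U a') *ᵥ v) = _
  rw [inner_weyl_weyl χ h2]
  have hUB : ∀ a l, sympForm (U a) (B l) = 0 := fun a l => by
    rw [sympForm_swap, hBU, neg_zero]
  have h0 : sympForm (-(B l + U a)) (B l' + U a') = 0 := by
    simp [sympForm_neg_left, sympForm_add_left, sympForm_add_right, hBB, hUU, hBU, hUB]
  have h1 : -(B l + U a) + (B l' + U a') = B (l' - l) + U (a' - a) := by
    simp only [map_sub]; abel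
  rw [h0, h1, zero_div, AddChar.map_zero_eq_one, one_mul]
  by_cases h : l = l' ∧ a = a'
  · obtain ⟨rfl, rfl⟩ := h
    simp [weyl_zero, hv1]
  · rw [Matrix.one_apply_ne (by simpa [Prod.ext_iff] using h)]
    have hne : ¬ ∀ x ∈ M, sympForm x (B (l' - l) + U (a' - a)) = 0 := by
      intro hx
      obtain ⟨ha, hb⟩ := hnd _ _ hx
      exact h ⟨(sub_eq_zero.1 ha).symm, (sub_eq_zero.1 hb).symm⟩
    push Not at hne
    obtain ⟨x, hx, hxne⟩ := hne
    have := hχ hxne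
    rw [AddChar.ne_one_iff] at this
    obtain ⟨r, hr⟩ := this
    rw [AddChar.mulShift_apply] at hr
    refine inner_weyl_eq_zero χ h2 (hv (r • x) (M.smul_mem r hx)) ?_
    rwa [sympForm_smul_left, mul_comm]

/-- Operators `W (ρ + U a₀)` with `ρ ∈ M` orthogonal to the logical space permute the vectors
`W (B l + U a) v` up to phases that do not depend on `l`. -/
lemma weyl_mulVec_encoded (h2 : (2 : A) ≠ 0) (hUU : ∀ a a', sympForm (U a) (U a') = 0)
    (hBU : ∀ l a, sympForm (B l) (U a) = 0) (hv : ∀ x ∈ M, weyl χ x *ᵥ v = v)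
    {ρ : (Fin n → A) × (Fin n → A)} (hρ : ρ ∈ M) (hρB : ∀ l, sympForm ρ (B l) = 0)
    (a₀ a : Fin c → A) (l : Fin k → A) :
    weyl χ (ρ + U a₀) *ᵥ (weyl χ (B l + U a) *ᵥ v) =
      χ ((sympForm ρ (U a) + sympForm ρ (U (a₀ + a))) / 2) •
        (weyl χ (B l + U (a₀ + a)) *ᵥ v) := by
  have hUB : ∀ a l, sympForm (U a) (B l) = 0 := fun a l => by
    rw [sympForm_swap, hBU, neg_zero]
  have h1 : ρ + U a₀ + (B l + U a) = B l + U (a₀ + a) + ρ := by rw [map_add]; abel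
  have h3 : weyl χ (B l + U (a₀ + a) + ρ) =
      χ (sympForm ρ (U (a₀ + a)) / 2) • (weyl χ (B l + U (a₀ + a)) * weyl χ ρ) := by
    rw [weyl_mul χ h2, smul_smul, ← AddChar.map_add_eq_mul,
      sympForm_swap (B l + U (a₀ + a)) ρ, sympForm_add_right, hρB, zero_add]
    have : sympForm ρ (U (a₀ + a)) / 2 + -sympForm ρ (U (a₀ + a)) / 2 = 0 := by ring
    rw [this, AddChar.map_zero_eq_one, one_smul]
  rw [Matrix.mulVec_mulVec, weyl_mul χ h2, h1, h3, smul_smul, ← AddChar.map_add_eq_mul,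
    Matrix.smul_mulVec, ← Matrix.mulVec_mulVec, hv ρ hρ]
  congr 2
  simp only [sympForm_add_left, sympForm_add_right, hUU, hUB, hρB]
  ring

/-- An entanglement-assisted code from a subspace `M` stabilizing the vector `|0⟩|0⟩`, and two
isotropic spaces `B`, `U` of shifts of the logical qudits and of the sender's halves. -/
theorem exists_isEAQECC_of_isotropic (h2 : (2 : A) ≠ 0) {d : ℕ}
    (hM : ∀ x ∈ M, ∀ y ∈ M, sympForm x y = 0)
    (hBB : ∀ l l', sympForm (B l) (B l') = 0) (hUU : ∀ a a', sympForm (U a) (U a') = 0)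
    (hBU : ∀ l a, sympForm (B l) (U a) = 0)
    (hnd : ∀ l a, (∀ x ∈ M, sympForm x (B l + U a) = 0) → l = 0 ∧ a = 0)
    (S : AddSubgroup ((Fin n → A) × (Fin n → A)))
    (hS : ∀ s ∈ S, ∃ ρ ∈ M, ∃ a₀, s = ρ + U a₀ ∧ ∀ l, sympForm ρ (B l) = 0)
    (hsurj : ∀ T : Finset (Fin n), T.card < d → ∀ z : (Fin n → A) × (Fin n → A),
      ∃ s ∈ S, ∀ i ∈ T, s.1 i = z.1 i ∧ s.2 i = z.2 i)
    (T₀ : Finset (Fin n)) (hT₀ : T₀.card = d) (ρ : (Fin n → A) × (Fin n → A)) (hρ : ρ ∈ M)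
    (l₀ : Fin k → A) (hl₀ : l₀ ≠ 0) (hρU : ∀ a, sympForm ρ (U a) = 0)
    (he : ∀ i, i ∉ T₀ → (ρ + B l₀).1 i = 0 ∧ (ρ + B l₀).2 i = 0) :
    ∃ V : Matrix (Fin n → A) ((Fin k → A) × (Fin c → A)) ℂ, IsEAQECC n k d c V := by
  obtain ⟨χ, hχ⟩ : ∃ χ : AddChar A ℂ, χ.IsPrimitive :=
    ⟨AddChar.FiniteField.primitiveChar_to_Complex A,
      AddChar.FiniteField.primitiveChar_to_Complex_isPrimitive A⟩
  obtain ⟨v, hv1, hv⟩ := exists_unit_fixed χ h2 M hM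
  have hiso := weylEncoder_isometry χ h2 hχ hBB hUU hBU hnd hv1 hv
  have hiso' : ∀ l a l' a', star (weyl χ (B l + U a) *ᵥ v) ⬝ᵥ (weyl χ (B l' + U a') *ᵥ v) =
      (1 : Matrix ((Fin k → A) × (Fin c → A)) ((Fin k → A) × (Fin c → A)) ℂ) (l, a) (l', a') :=
    fun l a l' a' => congrFun (congrFun hiso (l, a)) (l', a')
  have hpt : ∀ E l l', partialTrace (weylEncoder χ B U v) E l l' =
      ∑ a, star (weyl χ (B l + U a) *ᵥ v) ⬝ᵥ (E *ᵥ (weyl χ (B l' + U a) *ᵥ v)) :=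
    fun _ _ _ => rfl
  have hpt1 : ∀ l l', l ≠ l' → partialTrace (weylEncoder χ B U v) 1 l l' = 0 := by
    intro l l' h
    rw [hpt]
    refine Finset.sum_eq_zero fun a _ => ?_
    rw [Matrix.one_mulVec, hiso', Matrix.one_apply_ne (by simp [h])]
  refine ⟨weylEncoder χ B U v, hiso, fun T E hT hE => ?_, T₀, weyl χ (ρ + B l₀), hT₀,
    weyl_actsOn χ T₀ _ he, ?_⟩
  · classical
    rw [detects_iff]
    obtain ⟨μ, hμ⟩ := twirl_eq_smul_one χ hχ S T (hsurj T hT) E hE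
    rw [finsum_eq_sum_of_fintype] at hμ
    -- The phase is the same for l and l', so it cancels in the inner product, and the translation a
    -- ↦ a₀ + a only permutes the terms of the partial trace.
    have hinv : ∀ s ∈ S, ∀ l l', partialTrace (weylEncoder χ B U v)
        ((weyl χ s)ᴴ * E * weyl χ s) l l' = partialTrace (weylEncoder χ B U v) E l l' := by
      intro s hs l l'
      obtain ⟨ρ, hρ, a₀, rfl, hρB⟩ := hS s hs
      rw [hpt, hpt]
      refine Fintype.sum_equiv (Equiv.addLeft a₀) _ _ fun a => ?_
      rw [← star_dotProduct_mulVec, weyl_mulVec_encoded χ h2 hUU hBU hv hρ hρB,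
        weyl_mulVec_encoded χ h2 hUU hBU hv hρ hρB, Matrix.mulVec_smul, star_smul,
        smul_dotProduct, dotProduct_smul, smul_smul, star_addChar_mul_self, one_smul]
      rfl
    have hcard : (Fintype.card S : ℂ) ≠ 0 := by
      have : 0 < Fintype.card S := Fintype.card_pos
      exact_mod_cast this.ne'
    refine ⟨μ / Fintype.card S, fun l l' => ?_⟩
    have hadd : partialTrace (weylEncoder χ B U v)
        (∑ s : S, (weyl χ (s : (Fin n → A) × (Fin n → A)))ᴴ * E * weyl χ s) l l' =
        ∑ s : S, partialTrace (weylEncoder χ B U v)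
          ((weyl χ (s : (Fin n → A) × (Fin n → A)))ᴴ * E * weyl χ s) l l' := by
      simp only [hpt]
      rw [Finset.sum_comm]
      refine Finset.sum_congr rfl fun a _ => ?_
      rw [Matrix.sum_mulVec, dotProduct_sum]
    rw [hμ, Finset.sum_congr rfl fun (s : S) _ => hinv s s.2 l l', Finset.sum_const,
      Finset.card_univ, nsmul_eq_mul] at hadd
    have hsm : partialTrace (weylEncoder χ B U v) (μ • 1) l l' =
        μ * partialTrace (weylEncoder χ B U v) 1 l l' := by
      simp only [hpt, Matrix.smul_mulVec, dotProduct_smul, smul_eq_mul, Finset.mul_sum]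
    rw [hsm] at hadd
    field_simp
    rw [hadd]
    ring
  · rw [detects_iff]
    rintro ⟨μ, hμ⟩
    have h := hμ l₀ 0
    rw [hpt1 _ _ hl₀, mul_zero, hpt] at h
    have hUB : ∀ a l, sympForm (U a) (B l) = 0 := fun a l => by
      rw [sympForm_swap, hBU, neg_zero]
    -- The operator sends the logical label 0 to l₀ with a phase independent of a, so the terms of
    -- this off-diagonal entry add up without cancellation.
    have hterm : ∀ a, star (weyl χ (B l₀ + U a) *ᵥ v) ⬝ᵥ
        (weyl χ (ρ + B l₀) *ᵥ (weyl χ (B 0 + U a) *ᵥ v)) = χ (sympForm ρ (B l₀) / 2) := by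
      intro a
      have h1 : weyl χ (ρ + B l₀) *ᵥ (weyl χ (B 0 + U a) *ᵥ v) =
          χ (sympForm ρ (B l₀) / 2) • (weyl χ (B l₀ + U a) *ᵥ v) := by
        have h3 : ρ + B l₀ + (B 0 + U a) = B l₀ + U a + ρ := by rw [map_zero]; abel
        have h4 : weyl χ (B l₀ + U a + ρ) =
            χ (sympForm ρ (B l₀) / 2) • (weyl χ (B l₀ + U a) * weyl χ ρ) := by
          rw [weyl_mul χ h2, smul_smul, ← AddChar.map_add_eq_mul,
            sympForm_swap (B l₀ + U a) ρ, sympForm_add_right, hρU, add_zero]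
          have : sympForm ρ (B l₀) / 2 + -sympForm ρ (B l₀) / 2 = 0 := by ring
          rw [this, AddChar.map_zero_eq_one, one_smul]
        rw [Matrix.mulVec_mulVec, weyl_mul χ h2, h3, h4]
        simp only [map_zero, zero_add, sympForm_add_left, hρU, hBU, add_zero, zero_div,
          AddChar.map_zero_eq_one, one_smul]
        rw [Matrix.smul_mulVec, ← Matrix.mulVec_mulVec, hv ρ hρ]
      rw [h1, dotProduct_smul, hiso', Matrix.one_apply_eq, smul_eq_mul, mul_one]
    rw [Finset.sum_congr rfl fun a _ => hterm a, Finset.sum_const, nsmul_eq_mul] at h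
    have hne : χ (sympForm ρ (B l₀) / 2) ≠ 0 := fun h0 => by
      have := star_addChar_mul_self χ (sympForm ρ (B l₀) / 2)
      rw [h0, mul_zero] at this
      exact zero_ne_one this
    refine (mul_ne_zero ?_ hne) h
    rw [Nat.cast_ne_zero, Finset.card_univ]
    exact Fintype.card_ne_zero

end core

/-! ### Hermitian spaces over a quadratic extension -/

/-- The sesquilinear form `∑ σ (xᵢ) yᵢ`. -/
def hermForm {F : Type*} [Field F] {n : ℕ} (σ : F →+* F) (x y : Fin n → F) : F :=
  ∑ i, σ (x i) * y i

section herm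

variable {F : Type*} [Field F] {n : ℕ} (σ : F →+* F)

lemma hermForm_add_left (x y z : Fin n → F) :
    hermForm σ (x + y) z = hermForm σ x z + hermForm σ y z := by
  simp [hermForm, add_mul, Finset.sum_add_distrib]

lemma hermForm_add_right (x y z : Fin n → F) :
    hermForm σ x (y + z) = hermForm σ x y + hermForm σ x z := by
  simp [hermForm, mul_add, Finset.sum_add_distrib]

lemma hermForm_smul_left (c : F) (x y : Fin n → F) :
    hermForm σ (c • x) y = σ c * hermForm σ x y := by
  simp [hermForm, Finset.mul_sum, mul_assoc]

lemma hermForm_smul_right (c : F) (x y : Fin n → F) :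
    hermForm σ x (c • y) = c * hermForm σ x y := by
  simp only [hermForm, Finset.mul_sum, Pi.smul_apply, smul_eq_mul]
  exact Finset.sum_congr rfl fun i _ => by ring

lemma hermForm_sub_right (x y z : Fin n → F) :
    hermForm σ x (y - z) = hermForm σ x y - hermForm σ x z := by
  simp [hermForm, mul_sub, Finset.sum_sub_distrib]

lemma hermForm_zero_left (y : Fin n → F) : hermForm σ 0 y = 0 := by simp [hermForm]

lemma hermForm_zero_right (y : Fin n → F) : hermForm σ y 0 = 0 := by simp [hermForm]

lemma hermForm_sum_left {ι : Type*} (s : Finset ι) (f : ι → Fin n → F) (y : Fin n → F) :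
    hermForm σ (∑ i ∈ s, f i) y = ∑ i ∈ s, hermForm σ (f i) y := by
  classical
  induction s using Finset.induction_on with
  | empty => simp [hermForm_zero_left]
  | insert a s ha ih => rw [Finset.sum_insert ha, Finset.sum_insert ha, hermForm_add_left, ih]

lemma hermForm_sum_right {ι : Type*} (s : Finset ι) (f : ι → Fin n → F) (y : Fin n → F) :
    hermForm σ y (∑ i ∈ s, f i) = ∑ i ∈ s, hermForm σ y (f i) := by
  classical
  induction s using Finset.induction_on with
  | empty => simp [hermForm_zero_right]
  | insert a s ha ih => rw [Finset.sum_insert ha, Finset.sum_insert ha, hermForm_add_right, ih]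

variable {σ}

lemma hermForm_swap (hσ : ∀ x, σ (σ x) = x) (x y : Fin n → F) :
    hermForm σ y x = σ (hermForm σ x y) := by
  simp only [hermForm, map_sum, map_mul, hσ]
  exact Finset.sum_congr rfl fun i _ => mul_comm _ _

lemma hermForm_eq_zero_swap (hσ : ∀ x, σ (σ x) = x) {x y : Fin n → F} (h : hermForm σ x y = 0) :
    hermForm σ y x = 0 := by
  rw [hermForm_swap hσ, h, map_zero]

end herm

/-! ### From Hermitian to symplectic spaces -/

section bridge

variable {A F : Type*} [Field A] [Field F] [Algebra A F] {σ : F →+* F} {ε : F}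

lemma quadratic_ext (hσA : ∀ a : A, σ (algebraMap A F a) = algebraMap A F a) (hε : ε ≠ 0)
    (hσε : σ ε = -ε) (h2 : (2 : F) ≠ 0) {a b a' b' : A}
    (h : algebraMap A F a + ε * algebraMap A F b = algebraMap A F a' + ε * algebraMap A F b') :
    a = a' ∧ b = b' := by
  have h' := congrArg σ h
  simp only [map_add, map_mul, hσA, hσε] at h'
  have h1 : 2 * (algebraMap A F a - algebraMap A F a') = 0 := by linear_combination h + h'
  have h3 : 2 * ε * (algebraMap A F b - algebraMap A F b') = 0 := by linear_combination h - h'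
  have h1' := (mul_eq_zero.1 h1).resolve_left h2
  have h3' := (mul_eq_zero.1 h3).resolve_left (mul_ne_zero h2 hε)
  exact ⟨(algebraMap A F).injective (sub_eq_zero.1 h1'),
    (algebraMap A F).injective (sub_eq_zero.1 h3')⟩

/-- These are the coordinates in the basis 1, ε of F over the fixed field of σ, namely (x + σx)/2
and (x - σx)/(2ε). -/
lemma exists_re_im (hσ : ∀ x, σ (σ x) = x)
    (hσA : ∀ a : A, σ (algebraMap A F a) = algebraMap A F a)
    (hfix : ∀ x, σ x = x → ∃ a : A, algebraMap A F a = x) (hε : ε ≠ 0)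
    (hσε : σ ε = -ε) (h2 : (2 : F) ≠ 0) :
    ∃ re im : F →ₗ[A] A, (∀ x, x = algebraMap A F (re x) + ε * algebraMap A F (im x)) := by
  have h : ∀ x : F, ∃ p : A × A, x = algebraMap A F p.1 + ε * algebraMap A F p.2 := by
    intro x
    obtain ⟨a, ha⟩ := hfix ((x + σ x) / 2) (by
      rw [map_div₀, map_add, hσ, map_ofNat, add_comm])
    obtain ⟨b, hb⟩ := hfix ((x - σ x) / (2 * ε)) (by
      rw [map_div₀, map_sub, hσ, map_mul, hσε, map_ofNat, mul_neg, div_neg, ← neg_div, neg_sub])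
    refine ⟨(a, b), ?_⟩
    simp only [ha, hb]
    field_simp
    ring
  choose p hp using h
  refine ⟨⟨⟨fun x => (p x).1, fun x y => ?_⟩, fun c x => ?_⟩,
    ⟨⟨fun x => (p x).2, fun x y => ?_⟩, fun c x => ?_⟩, hp⟩
  · refine (quadratic_ext hσA hε hσε h2 (b' := (p x).2 + (p y).2) ((hp (x + y)).symm.trans ?_)).1
    conv_lhs => rw [hp x, hp y]
    simp only [map_add]; ring
  · refine (quadratic_ext hσA hε hσε h2 (b' := c * (p x).2) ((hp (c • x)).symm.trans ?_)).1
    conv_lhs => rw [hp x, Algebra.smul_def]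
    simp only [map_mul, RingHom.id_apply, smul_eq_mul]; ring
  · refine (quadratic_ext hσA hε hσε h2 (a' := (p x).1 + (p y).1) ((hp (x + y)).symm.trans ?_)).2
    conv_lhs => rw [hp x, hp y]
    simp only [map_add]; ring
  · refine (quadratic_ext hσA hε hσε h2 (a' := c * (p x).1) ((hp (c • x)).symm.trans ?_)).2
    conv_lhs => rw [hp x, Algebra.smul_def]
    simp only [map_mul, RingHom.id_apply, smul_eq_mul]; ring

variable [Fintype A] [DecidableEq A] {n k c d : ℕ}

/-- The entanglement-assisted code of a linear code `S` and its Hermitian dual `D`, given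
orthogonal bases of complements of `S ⊓ D` in `S` and in `D`. -/
theorem exists_isEAQECC_of_orthogonal (hσ : ∀ x, σ (σ x) = x)
    (hσA : ∀ a : A, σ (algebraMap A F a) = algebraMap A F a)
    (hfix : ∀ x, σ x = x → ∃ a : A, algebraMap A F a = x) (hε : ε ≠ 0)
    (hσε : σ ε = -ε) (h2 : (2 : F) ≠ 0) (S D : Submodule F (Fin n → F))
    (hSD : ∀ s ∈ S, ∀ x ∈ D, hermForm σ s x = 0)
    (u : Fin c → Fin n → F) (w : Fin k → Fin n → F) (hu : ∀ i, u i ∈ S) (hw : ∀ j, w j ∈ D)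
    (huu : ∀ i j, i ≠ j → hermForm σ (u i) (u j) = 0) (hu0 : ∀ i, hermForm σ (u i) (u i) ≠ 0)
    (hww : ∀ i j, i ≠ j → hermForm σ (w i) (w j) = 0) (hw0 : ∀ i, hermForm σ (w i) (w i) ≠ 0)
    (hSdec : ∀ s ∈ S, ∃ a : Fin c → F, ∃ r ∈ S ⊓ D, s = r + ∑ i, a i • u i)
    (hDdec : ∀ x ∈ D, ∃ b : Fin k → F, ∃ r ∈ S ⊓ D, x = r + ∑ j, b j • w j)
    (hsurj : ∀ T : Finset (Fin n), T.card < d → ∀ y : Fin n → F, ∃ s ∈ S, ∀ i ∈ T, s i = y i)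
    (T₀ : Finset (Fin n)) (hT₀ : T₀.card = d) (e : Fin n → F) (heD : e ∈ D) (heS : e ∉ S)
    (he : ∀ i, i ∉ T₀ → e i = 0) :
    ∃ V : Matrix (Fin n → A) ((Fin k → A) × (Fin c → A)) ℂ, IsEAQECC n k d c V := by
  obtain ⟨re, im, hri⟩ := exists_re_im hσ hσA hfix hε hσε h2
  have huniq : ∀ a b : A, ∀ x : F, x = algebraMap A F a + ε * algebraMap A F b →
      re x = a ∧ im x = b := fun a b x h =>
    quadratic_ext hσA hε hσε h2 ((hri x).symm.trans h)
  set ν : (Fin n → F) →ₗ[A] (Fin n → A) × (Fin n → A) :=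
    LinearMap.prod (LinearMap.compLeft re (Fin n)) (LinearMap.compLeft im (Fin n)) with hν
  have hν1 : ∀ x i, (ν x).1 i = re (x i) := fun _ _ => rfl
  have hν2 : ∀ x i, (ν x).2 i = im (x i) := fun _ _ => rfl
  have hσx : ∀ x, σ x = algebraMap A F (re x) - ε * algebraMap A F (im x) := by
    intro x
    conv_lhs => rw [hri x]
    simp only [map_add, map_mul, hσA, hσε]
    ring
  have hsq : ∃ g : A, algebraMap A F g = ε * ε := hfix _ (by rw [map_mul, hσε]; ring)
  obtain ⟨g, hg⟩ := hsq
  have him : ∀ x y : F, im (σ x * y) = re x * im y - im x * re y := by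
    intro x y
    refine (huniq (re x * re y - g * (im x * im y)) _ _ ?_).2
    rw [hσx]
    conv_lhs => rw [hri y]
    simp only [map_sub, map_mul, hg]
    ring
  have hsymp : ∀ x y, sympForm (ν x) (ν y) = -im (hermForm σ x y) := by
    intro x y
    simp only [sympForm, hermForm, map_sum, him, ← Finset.sum_neg_distrib, hν1, hν2]
    exact Finset.sum_congr rfl fun i _ => by ring
  have hsymp0 : ∀ x y, hermForm σ x y = 0 → sympForm (ν x) (ν y) = 0 := fun x y h => by
    rw [hsymp, h, map_zero, neg_zero]
  have himA : ∀ a : A, im (algebraMap A F a) = 0 := fun a =>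
    (huniq a 0 _ (by simp)).2
  have hA2 : (2 : A) ≠ 0 := fun h => h2 (by rw [← map_ofNat (algebraMap A F) 2, h, map_zero])
  have hgam : ∀ x : Fin n → F, ∃ γ : A, algebraMap A F γ = hermForm σ x x := fun x =>
    hfix _ (hermForm_swap hσ x x).symm
  set f : Fin c ⊕ Fin k → Fin n → F := Sum.elim u w with hf
  have hff : ∀ i j, i ≠ j → hermForm σ (f i) (f j) = 0 := by
    rintro (i | i) (j | j) hij
    · exact huu i j fun h => hij (by rw [h])
    · exact hSD _ (hu i) _ (hw j)
    · exact hermForm_eq_zero_swap hσ (hSD _ (hu j) _ (hw i))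
    · exact hww i j fun h => hij (by rw [h])
  choose γ hγ using fun i => hgam (f i)
  have hγ0 : ∀ i, γ i ≠ 0 := by
    intro i h
    have h3 := hγ i
    rw [h, map_zero] at h3
    rcases i with i | i
    · exact hu0 i h3.symm
    · exact hw0 i h3.symm
  set N : (Fin c ⊕ Fin k → A) →ₗ[A] (Fin n → F) := Fintype.linearCombination A f with hN
  have hNapp : ∀ a, N a = ∑ i, algebraMap A F (a i) • f i := fun a => by
    simp only [hN, Fintype.linearCombination_apply, algebraMap_smul]
  have hfN : ∀ i b, hermForm σ (f i) (N b) = algebraMap A F (γ i * b i) := by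
    intro i b
    rw [hNapp, hermForm_sum_right, Finset.sum_eq_single i]
    · rw [hermForm_smul_right, ← hγ, map_mul, mul_comm]
    · intro j _ hj
      rw [hermForm_smul_right, hff i j (Ne.symm hj), mul_zero]
    · simp
  have hNN : ∀ a b, hermForm σ (N a) (N b) = algebraMap A F (∑ i, a i * (γ i * b i)) := by
    intro a b
    rw [hNapp a, hermForm_sum_left, map_sum]
    refine Finset.sum_congr rfl fun i _ => ?_
    rw [hermForm_smul_left, hσA, hfN, ← map_mul]
  have hrf : ∀ r ∈ S ⊓ D, ∀ i, hermForm σ r (f i) = 0 := by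
    rintro r ⟨hrS, hrD⟩ (i | i)
    · exact hermForm_eq_zero_swap hσ (hSD _ (hu i) _ hrD)
    · exact hSD _ hrS _ (hw i)
  have hrN : ∀ r ∈ S ⊓ D, ∀ a, hermForm σ r (N a) = 0 := by
    intro r hr a
    rw [hNapp, hermForm_sum_right]
    exact Finset.sum_eq_zero fun i _ => by rw [hermForm_smul_right, hrf r hr, mul_zero]
  have hrr : ∀ r ∈ S ⊓ D, ∀ r' ∈ S ⊓ D, hermForm σ r r' = 0 := fun r hr r' hr' =>
    hSD _ hr.1 _ hr'.2
  -- Isotropic because ε N(a) and ε N(a') have form -ε² ∑ a γ a', which lies in A and so has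
  -- imaginary part 0. It still detects every shift along u and w, as ε fᵢ pairs with fᵢ to a
  -- nonzero multiple of ε.
  let M : Submodule A ((Fin n → A) × (Fin n → A)) :=
    { carrier := {z | ∃ r ∈ S ⊓ D, ∃ a, z = ν (r + ε • N a)}
      add_mem' := by
        rintro _ _ ⟨r, hr, a, rfl⟩ ⟨r', hr', a', rfl⟩
        refine ⟨r + r', add_mem hr hr', a + a', ?_⟩
        rw [← map_add, map_add N, smul_add]
        congr 1; abel
      zero_mem' := ⟨0, zero_mem _, 0, by simp⟩
      smul_mem' := by
        rintro b _ ⟨r, hr, a, rfl⟩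
        refine ⟨algebraMap A F b • r, Submodule.smul_mem _ _ hr, b • a, ?_⟩
        rw [← map_smul, map_smul N, smul_add, algebraMap_smul, smul_comm] }
  have hMmem : ∀ r ∈ S ⊓ D, ∀ a, ν (r + ε • N a) ∈ M := fun r hr a => ⟨r, hr, a, rfl⟩
  set U : (Fin c → A) →ₗ[A] (Fin n → F) := Fintype.linearCombination A u with hU
  set B : (Fin k → A) →ₗ[A] (Fin n → F) := Fintype.linearCombination A w with hB
  have hNU : ∀ a, N (Sum.elim a 0) = U a := fun a => by
    simp [hN, hU, Fintype.linearCombination_apply, Fintype.sum_sum_type, hf]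
  have hNB : ∀ b, N (Sum.elim 0 b) = B b := fun b => by
    simp [hN, hB, Fintype.linearCombination_apply, Fintype.sum_sum_type, hf]
  have hNBU : ∀ a b, N (Sum.elim a b) = B b + U a := fun a b => by
    simp [hN, hB, hU, Fintype.linearCombination_apply, Fintype.sum_sum_type, hf, add_comm]
  have hUapp : ∀ a, U a = ∑ i, algebraMap A F (a i) • u i := fun a => by
    simp only [hU, Fintype.linearCombination_apply, algebraMap_smul]
  have hBapp : ∀ a, B a = ∑ i, algebraMap A F (a i) • w i := fun a => by
    simp only [hB, Fintype.linearCombination_apply, algebraMap_smul]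
  have hUS : ∀ a, U a ∈ S := fun a => by
    rw [hUapp]; exact Submodule.sum_mem _ fun i _ => S.smul_mem _ (hu i)
  have hBD : ∀ a, B a ∈ D := fun a => by
    rw [hBapp]; exact Submodule.sum_mem _ fun i _ => D.smul_mem _ (hw i)
  have hsplit : ∀ {m : ℕ} (a : Fin m → F) (v : Fin m → Fin n → F), ∑ i, a i • v i =
      ε • (∑ i, algebraMap A F (im (a i)) • v i) + ∑ i, algebraMap A F (re (a i)) • v i := by
    intro m a v
    rw [Finset.smul_sum, ← Finset.sum_add_distrib]
    refine Finset.sum_congr rfl fun i _ => ?_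
    conv_lhs => rw [hri (a i)]
    rw [add_smul, mul_smul, add_comm]
  -- Dividing e by a nonzero coefficient b j makes that coefficient 1. The real part of the
  -- coefficient vector is then a nonzero logical label l₀, while the radical part and the ε-part
  -- lie in M.
  obtain ⟨b, r, hr, heq⟩ := hDdec e heD
  have hb : b ≠ 0 := by
    rintro rfl
    apply heS
    rw [heq]
    simpa using hr.1
  obtain ⟨j, hj⟩ := Function.ne_iff.1 hb
  have hre1 : re 1 = 1 := (huniq 1 0 1 (by simp)).1
  refine exists_isEAQECC_of_isotropic (M := M) (B := ν ∘ₗ B) (U := ν ∘ₗ U) hA2 ?_ ?_ ?_ ?_ ?_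
    ((S.toAddSubgroup).map ν.toAddMonoidHom) ?_ ?_ T₀ hT₀
    (ν ((b j)⁻¹ • r + ε • B (fun i => im ((b j)⁻¹ * b i)))) ?_
    (fun i => re ((b j)⁻¹ * b i)) ?_ ?_ ?_
  · rintro _ ⟨r, hr, a, rfl⟩ _ ⟨r', hr', a', rfl⟩
    rw [hsymp, hermForm_add_left, hermForm_add_right, hermForm_add_right, hrr r hr r' hr',
      hermForm_smul_left, hermForm_smul_left, hermForm_smul_right, hermForm_smul_right, hrN r hr,
      hermForm_eq_zero_swap hσ (hrN r' hr' a), hNN, hσε]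
    have : -ε * (ε * algebraMap A F (∑ i, a i * (γ i * a' i))) =
        algebraMap A F (-g * ∑ i, a i * (γ i * a' i)) := by
      rw [map_mul, map_neg, hg]; ring
    simp only [mul_zero, zero_add]
    rw [this, himA, neg_zero]
  · intro l l'
    simp only [LinearMap.comp_apply]
    rw [hsymp, ← hNB, ← hNB, hNN, himA, neg_zero]
  · intro l l'
    simp only [LinearMap.comp_apply]
    rw [hsymp, ← hNU, ← hNU, hNN, himA, neg_zero]
  · intro l a
    simp only [LinearMap.comp_apply]
    exact hsymp0 _ _ (hermForm_eq_zero_swap hσ (hSD _ (hUS a) _ (hBD l)))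
  · intro l a h
    have h0 : ∀ i, (Sum.elim a l : Fin c ⊕ Fin k → A) i = 0 := by
      intro i
      have h1 := h _ (hMmem 0 (zero_mem _) (Pi.single i 1))
      simp only [LinearMap.comp_apply] at h1
      have h3 : N (Pi.single i 1) = f i := by
        simp [hN]
      rw [← map_add, ← hNBU, hsymp, h3, zero_add, hermForm_smul_left, hfN, hσε] at h1
      have h4 := (huniq 0 (-(γ i * (Sum.elim a l : Fin c ⊕ Fin k → A) i))
        (-ε * algebraMap A F (γ i * (Sum.elim a l : Fin c ⊕ Fin k → A) i)) (by
          rw [map_neg, map_zero]; ring)).2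
      rw [h4, neg_neg] at h1
      exact (mul_eq_zero.1 h1).resolve_left (hγ0 i)
    exact ⟨funext fun i => h0 (Sum.inr i), funext fun i => h0 (Sum.inl i)⟩
  · rintro _ ⟨s, hs, rfl⟩
    obtain ⟨a, r, hr, rfl⟩ := hSdec s hs
    -- The imaginary parts of the coefficients go into the stabilizer, the real parts become the
    -- shift a₀ of the sender's label.
    refine ⟨ν (r + ε • U (fun i => im (a i))), ?_, fun i => re (a i), ?_, ?_⟩
    · rw [← hNU]; exact hMmem r hr _
    · rw [LinearMap.comp_apply, ← map_add, hUapp, hUapp, add_assoc, ← hsplit]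
      rfl
    · intro l
      exact hsymp0 _ _ (hSD _ (add_mem hr.1 (S.smul_mem _ (hUS _))) _ (hBD l))
  · intro T hT z
    obtain ⟨s, hs, hsT⟩ := hsurj T hT fun i => algebraMap A F (z.1 i) + ε * algebraMap A F (z.2 i)
    refine ⟨ν s, ⟨s, hs, rfl⟩, fun i hi => ?_⟩
    rw [hν1, hν2, hsT i hi]
    exact huniq _ _ _ rfl
  · rw [← hNB]; exact hMmem _ (Submodule.smul_mem _ _ hr) _
  · intro h
    have := congrFun h j
    simp only [Pi.zero_apply] at this
    rw [inv_mul_cancel₀ hj, hre1] at this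
    exact one_ne_zero this
  · intro a
    exact hsymp0 _ _ (hermForm_eq_zero_swap hσ (hSD _ (hUS a) _
      (add_mem (D.smul_mem _ hr.2) (D.smul_mem _ (hBD _)))))
  · intro i hi
    have : ν ((b j)⁻¹ • r + ε • B (fun i => im ((b j)⁻¹ * b i))) +
        (ν ∘ₗ B) (fun i => re ((b j)⁻¹ * b i)) = ν ((b j)⁻¹ • e) := by
      rw [LinearMap.comp_apply, ← map_add, hBapp, hBapp, add_assoc, ← hsplit, heq, smul_add,
        Finset.smul_sum]
      simp only [smul_smul]
    rw [this, hν1, hν2]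
    simp [he i hi]

end bridge

/-! ### Orthogonal families and ranks -/

section gramSchmidt

variable {F : Type*} [Field F] {n : ℕ} {σ : F →+* F}

/-- The orthogonal complement for the Hermitian form. -/
def hermDual (σ : F →+* F) (S : Submodule F (Fin n → F)) : Submodule F (Fin n → F) where
  carrier := {x | ∀ s ∈ S, hermForm σ s x = 0}
  add_mem' hx hy s hs := by rw [hermForm_add_right, hx s hs, hy s hs, add_zero]
  zero_mem' s _ := hermForm_zero_right σ s
  smul_mem' c x hx s hs := by rw [hermForm_smul_right, hx s hs, mul_zero]

/-- A space without anisotropic vectors is totally isotropic. -/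
lemma hermForm_eq_zero_of_self (hσ : ∀ x, σ (σ x) = x) (h2 : (2 : F) ≠ 0)
    {V : Submodule F (Fin n → F)} (hV : ∀ x ∈ V, hermForm σ x x = 0) :
    ∀ x ∈ V, ∀ y ∈ V, hermForm σ x y = 0 := by
  intro x hx y hy
  by_contra ht
  -- The scaling makes each of the two cross terms equal to 1, so isotropy of this vector would give
  -- 2 = 0.
  have h := hV (x + (hermForm σ x y)⁻¹ • y) (add_mem hx (V.smul_mem _ hy))
  rw [hermForm_add_left, hermForm_add_right, hermForm_add_right, hV x hx, hermForm_smul_left,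
    hermForm_smul_left, hermForm_smul_right, hermForm_smul_right, hV y hy, hermForm_swap hσ x y,
    ← map_mul, inv_mul_cancel₀ ht, map_one] at h
  apply h2
  linear_combination h

/-- Every subspace has an orthogonal family of anisotropic vectors spanning a complement of its
radical. -/
theorem exists_orthogonal_family (hσ : ∀ x, σ (σ x) = x) (h2 : (2 : F) ≠ 0)
    (V : Submodule F (Fin n → F)) :
    ∃ (c : ℕ) (u : Fin c → Fin n → F), (∀ i, u i ∈ V) ∧
      (∀ i j, i ≠ j → hermForm σ (u i) (u j) = 0) ∧ (∀ i, hermForm σ (u i) (u i) ≠ 0) ∧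
      ∀ x ∈ V, ∃ a : Fin c → F, ∃ r ∈ V ⊓ hermDual σ V, x = r + ∑ i, a i • u i := by
  induction hd : Module.finrank F V using Nat.strong_induction_on generalizing V with
  | _ d ih =>
    by_cases hV : ∀ x ∈ V, hermForm σ x x = 0
    · refine ⟨0, Fin.elim0, fun i => i.elim0, fun i => i.elim0, fun i => i.elim0, fun x hx => ?_⟩
      exact ⟨Fin.elim0, x, ⟨hx, fun s hs => hermForm_eq_zero_of_self hσ h2 hV s hs x hx⟩,
        by simp⟩
    · push Not at hV
      obtain ⟨v, hv, hv0⟩ := hV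
      set V' : Submodule F (Fin n → F) := V ⊓ hermDual σ (Submodule.span F {v}) with hV'
      have hV'v : ∀ x ∈ V', hermForm σ v x = 0 := fun x hx =>
        hx.2 v (Submodule.mem_span_singleton_self v)
      have hmem : ∀ x ∈ V, hermForm σ v x = 0 → x ∈ V' := by
        refine fun x hx hvx => ⟨hx, fun s hs => ?_⟩
        obtain ⟨c, rfl⟩ := Submodule.mem_span_singleton.1 hs
        rw [hermForm_smul_left, hvx, mul_zero]
      have hlt : Module.finrank F V' < d := by
        rw [← hd]
        refine Submodule.finrank_lt_finrank_of_lt (lt_of_le_of_ne inf_le_left fun h => ?_)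
        exact hv0 (hV'v v (h ▸ hv))
      have hproj : ∀ x ∈ V, ∃ c : F, ∃ x' ∈ V', x = x' + c • v := by
        intro x hx
        refine ⟨hermForm σ v x / hermForm σ v v, x - (hermForm σ v x / hermForm σ v v) • v,
          hmem _ (sub_mem hx (V.smul_mem _ hv)) ?_, by abel⟩
        rw [hermForm_sub_right, hermForm_smul_right, div_mul_cancel₀ _ hv0, sub_self]
      obtain ⟨c, u, huV, huu, hu0, hdec⟩ := ih _ hlt V' rfl
      refine ⟨c + 1, Fin.cons v u, ?_, ?_, ?_, ?_⟩
      · intro i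
        refine Fin.cases hv (fun i => ?_) i
        exact (huV i).1
      · intro i j
        refine Fin.cases ?_ (fun i => ?_) i <;> refine Fin.cases ?_ (fun j => ?_) j
        · simp
        · intro _; exact hV'v _ (huV j)
        · intro _; exact hermForm_eq_zero_swap hσ (hV'v _ (huV i))
        · intro hij; exact huu i j fun h => hij (by rw [h])
      · intro i
        refine Fin.cases hv0 (fun i => ?_) i
        exact hu0 i
      · intro x hx
        obtain ⟨b, x', hx', rfl⟩ := hproj x hx
        obtain ⟨a, r, hr, rfl⟩ := hdec x' hx'
        refine ⟨Fin.cons b a, r, ⟨hr.1.1, fun s hs => ?_⟩, ?_⟩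
        · obtain ⟨b', s', hs', rfl⟩ := hproj s hs
          rw [hermForm_add_left, hermForm_smul_left, hr.2 s' hs', hV'v r hr.1]
          simp
        · rw [Fin.sum_univ_succ]
          simp only [Fin.cons_zero, Fin.cons_succ]
          abel

lemma finrank_eq_of_orthogonal_family {V R : Submodule F (Fin n → F)} (hRV : R ≤ V)
    (hR : ∀ x ∈ V, ∀ r ∈ R, hermForm σ x r = 0) {c : ℕ} {u : Fin c → Fin n → F}
    (hu : ∀ i, u i ∈ V) (huu : ∀ i j, i ≠ j → hermForm σ (u i) (u j) = 0)
    (hu0 : ∀ i, hermForm σ (u i) (u i) ≠ 0)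
    (hdec : ∀ x ∈ V, ∃ a : Fin c → F, ∃ r ∈ R, x = r + ∑ i, a i • u i) :
    Module.finrank F V = c + Module.finrank F R := by
  set L : (Fin c → F) × R →ₗ[F] (Fin n → F) :=
    (Fintype.linearCombination F u).coprod R.subtype with hL
  have hLapp : ∀ a r, L (a, r) = ∑ i, a i • u i + (r : Fin n → F) := fun a r => by
    simp [hL, Fintype.linearCombination_apply]
  have hinj : Function.Injective L := by
    rw [injective_iff_map_eq_zero]
    rintro ⟨a, r⟩ h
    rw [hLapp] at h
    have ha : a = 0 := by
      funext j
      have h1 : hermForm σ (u j) (∑ i, a i • u i + (r : Fin n → F)) = 0 := by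
        rw [h, hermForm_zero_right]
      rw [hermForm_add_right, hR _ (hu j) _ r.2, add_zero, hermForm_sum_right,
        Finset.sum_eq_single j, hermForm_smul_right] at h1
      · exact (mul_eq_zero.1 h1).resolve_right (hu0 j)
      · intro b _ hb
        rw [hermForm_smul_right, huu j b (Ne.symm hb), mul_zero]
      · simp
    subst ha
    simpa using h
  have hrange : LinearMap.range L = V := by
    ext x
    constructor
    · rintro ⟨⟨a, r⟩, rfl⟩
      rw [hLapp]
      exact add_mem (Submodule.sum_mem _ fun i _ => V.smul_mem _ (hu i)) (hRV r.2)
    · intro hx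
      obtain ⟨a, r, hr, rfl⟩ := hdec x hx
      exact ⟨(a, ⟨r, hr⟩), by rw [hLapp, add_comm]⟩
  rw [← hrange, LinearMap.finrank_range_of_inj hinj, Module.finrank_prod, Module.finrank_fin_fun]

end gramSchmidt

/-! ### Information sets -/

section infoSet

variable {F : Type*} [Field F] {n : ℕ} {σ : F →+* F}

/-- `b t`, `t ∈ T`, is the systematic basis of `S` for the information set `T`. -/
structure IsSystematic (S : Submodule F (Fin n → F)) (T : Finset (Fin n))
    (b : Fin n → Fin n → F) : Prop where
  mem : ∀ t, b t ∈ S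
  apply : ∀ t ∈ T, ∀ i ∈ T, b t i = if i = t then 1 else 0
  eq_zero : ∀ s ∈ S, (∀ i ∈ T, s i = 0) → s = 0

variable {S : Submodule F (Fin n → F)} {T : Finset (Fin n)} {b : Fin n → Fin n → F}

lemma IsSystematic.eq_sum (h : IsSystematic S T b) {s : Fin n → F} (hs : s ∈ S) :
    s = ∑ t ∈ T, s t • b t := by
  rw [← sub_eq_zero]
  refine h.eq_zero _ (sub_mem hs (Submodule.sum_mem _ fun t _ => S.smul_mem _ (h.mem t)))
    fun i hi => ?_
  rw [Pi.sub_apply, Finset.sum_apply, Finset.sum_eq_single i]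
  · simp [h.apply i hi i hi]
  · intro t ht hti
    simp [h.apply t ht i hi, Ne.symm hti]
  · exact fun h => absurd hi h

lemma IsSystematic.finrank_eq (h : IsSystematic S T b) : Module.finrank F S = T.card := by
  set L : S →ₗ[F] (T → F) := (LinearMap.funLeft F F (fun t : T => (t : Fin n))) ∘ₗ S.subtype with hL
  have hLapp : ∀ s t, L s t = (s : Fin n → F) t := fun _ _ => rfl
  have hbij : Function.Bijective L := by
    constructor
    · rw [injective_iff_map_eq_zero]
      intro s hs
      exact Subtype.ext (h.eq_zero _ s.2 fun i hi => by rw [← hLapp s ⟨i, hi⟩, hs]; rfl)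
    · intro y
      refine ⟨⟨∑ t : T, y t • b t, Submodule.sum_mem _ fun t _ => S.smul_mem _ (h.mem t)⟩, ?_⟩
      funext i
      rw [hLapp]
      simp only [Finset.sum_apply, Pi.smul_apply, smul_eq_mul]
      rw [Finset.sum_eq_single i]
      · simp [h.apply i i.2 i i.2]
      · intro t _ hti
        rw [h.apply t t.2 i i.2, if_neg fun e => hti (Subtype.ext e.symm), mul_zero]
      · simp
  rw [(LinearEquiv.ofBijective L hbij).finrank_eq, Module.finrank_fintype_fun_eq_card,
    Fintype.card_coe]

lemma IsSystematic.mem_hermDual_iff (h : IsSystematic S T b) {x : Fin n → F} :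
    x ∈ hermDual σ S ↔ ∀ t ∈ T, hermForm σ (b t) x = 0 := by
  refine ⟨fun hx t _ => hx _ (h.mem t), fun hx s hs => ?_⟩
  rw [h.eq_sum hs, hermForm_sum_left]
  exact Finset.sum_eq_zero fun t ht => by rw [hermForm_smul_left, hx t ht, mul_zero]

lemma IsSystematic.hermForm_of_support (h : IsSystematic S T b) {x : Fin n → F}
    (hx : ∀ i, i ∉ T → x i = 0) {t : Fin n} (ht : t ∈ T) : hermForm σ (b t) x = x t := by
  rw [hermForm, Finset.sum_eq_single t]
  · simp [h.apply t ht t ht]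
  · intro i _ hit
    by_cases hi : i ∈ T
    · simp [h.apply t ht i hi, hit]
    · rw [hx i hi, mul_zero]
  · simp

/-- Pairing with the systematic basis is onto, since a word supported on T simply returns its own
entries; the kernel is the dual. -/
lemma IsSystematic.finrank_hermDual (h : IsSystematic S T b) :
    Module.finrank F (hermDual σ S) + T.card = n := by
  set P : (Fin n → F) →ₗ[F] (T → F) :=
    { toFun := fun x t => hermForm σ (b t) x
      map_add' := fun x y => funext fun t => hermForm_add_right σ _ _ _
      map_smul' := fun c x => funext fun t => hermForm_smul_right σ _ _ _ } with hP
  have hker : LinearMap.ker P = hermDual σ S := by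
    ext x
    rw [h.mem_hermDual_iff, LinearMap.mem_ker, funext_iff, Subtype.forall]
    rfl
  have hsurj : LinearMap.range P = ⊤ := by
    rw [LinearMap.range_eq_top]
    intro y
    classical
    refine ⟨fun i => if hi : i ∈ T then y ⟨i, hi⟩ else 0, funext fun t => ?_⟩
    change hermForm σ (b t) _ = _
    rw [h.hermForm_of_support (fun i hi => dif_neg hi) t.2, dif_pos t.2]
  have := LinearMap.finrank_range_add_finrank_ker P
  rw [hker, hsurj, finrank_top, Module.finrank_fintype_fun_eq_card, Fintype.card_coe,
    Module.finrank_fin_fun] at this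
  omega

/-- The word of the dual code with information symbol `1` at `i`. -/
def dualWord (σ : F →+* F) (T : Finset (Fin n)) (b : Fin n → Fin n → F) (i : Fin n) : Fin n → F :=
  Pi.single i 1 - ∑ t ∈ T, σ (b t i) • Pi.single t 1

lemma dualWord_apply_of_notMem {i l : Fin n} (hl : l ∉ T) :
    dualWord σ T b i l = (Pi.single i 1 : Fin n → F) l := by
  rw [dualWord, Pi.sub_apply, Finset.sum_apply, Finset.sum_eq_zero, sub_zero]
  intro t ht
  have : l ≠ t := fun e => hl (e ▸ ht)
  simp [this]

lemma IsSystematic.dualWord_mem (h : IsSystematic S T b) (i : Fin n) :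
    dualWord σ T b i ∈ hermDual σ S := by
  rw [h.mem_hermDual_iff]
  intro t ht
  rw [dualWord, hermForm_sub_right, hermForm_sum_right, Finset.sum_eq_single t]
  · simp [hermForm, Pi.single_apply, h.apply t ht t ht]
  · intro t' ht' htt
    simp [hermForm, Pi.single_apply, h.apply t ht t' ht', htt]
  · exact fun h => absurd ht h

/-- `S` is its own double dual. -/
lemma IsSystematic.mem_of_dual (h : IsSystematic S T b) (hσ : ∀ x, σ (σ x) = x) {x : Fin n → F}
    (hx : x ∈ hermDual σ (hermDual σ S)) : x ∈ S := by
  set s := ∑ t ∈ T, x t • b t with hs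
  have hsS : s ∈ S := Submodule.sum_mem _ fun t _ => S.smul_mem _ (h.mem t)
  have hsx : ∀ i ∈ T, (x - s) i = 0 := by
    intro i hi
    rw [Pi.sub_apply, hs, Finset.sum_apply, Finset.sum_eq_single i]
    · simp [h.apply i hi i hi]
    · intro t ht hti
      simp [h.apply t ht i hi, Ne.symm hti]
    · exact fun h => absurd hi h
  have : x = s := by
    rw [← sub_eq_zero]
    funext i
    by_cases hi : i ∈ T
    · exact hsx i hi
    · have h1 : hermForm σ (dualWord σ T b i) (x - s) = 0 := by
        rw [hermForm_sub_right, hx _ (h.dualWord_mem i),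
          hermForm_eq_zero_swap hσ (h.dualWord_mem i s hsS), sub_zero]
      rw [hermForm, Finset.sum_eq_single i, dualWord_apply_of_notMem hi] at h1
      · simpa using h1
      · intro l _ hl
        by_cases hlT : l ∈ T
        · rw [hsx l hlT, mul_zero]
        · rw [dualWord_apply_of_notMem hlT]; simp [hl]
      · simp
  rw [this]; exact hsS

/-- If the dual of `S` is not contained in `S`, some dual word of weight at most `|T| + 1` is not
in `S`. -/
lemma IsSystematic.exists_dualWord_notMem (h : IsSystematic S T b)
    (hD : ¬ hermDual σ S ≤ S) : ∃ i, i ∉ T ∧ dualWord σ T b i ∉ S := by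
  by_contra! hall
  refine hD fun x hx => ?_
  have hxe : x = ∑ i ∈ Tᶜ, x i • dualWord σ T b i := by
    rw [← sub_eq_zero]
    set z := x - ∑ i ∈ Tᶜ, x i • dualWord σ T b i with hz
    have hzD : z ∈ hermDual σ S :=
      sub_mem hx (Submodule.sum_mem _ fun i _ => Submodule.smul_mem _ _ (h.dualWord_mem i))
    have hz0 : ∀ i, i ∉ T → z i = 0 := by
      intro i hi
      rw [hz, Pi.sub_apply, Finset.sum_apply, Finset.sum_eq_single i]
      · simp [dualWord_apply_of_notMem hi]
      · intro j _ hj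
        simp [dualWord_apply_of_notMem hi, Ne.symm hj]
      · intro hi'; exact absurd (Finset.mem_compl.2 hi) hi'
    funext i
    by_cases hi : i ∈ T
    · rw [← h.hermForm_of_support (σ := σ) hz0 hi]
      exact hzD _ (h.mem i)
    · exact hz0 i hi
  rw [hxe]
  exact Submodule.sum_mem _ fun i hi => S.smul_mem _ (hall i (Finset.mem_compl.1 hi))

end infoSet

/-! ### Words with Fourier support in an interval -/

section fourier

variable {K : Type*} [Field K] {n : ℕ}

/-- The word with Fourier coefficients `a`, placed at the frequencies `-m, …, m`. -/
def fourierMap (β : K) (n m : ℕ) : (Fin (2 * m + 1) → K) →ₗ[K] (Fin n → K) where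
  toFun a i := ∑ j, a j * β ^ (((i : ℕ) : ℤ) * (((j : ℕ) : ℤ) - m))
  map_add' a b := by
    funext i
    simp only [Pi.add_apply, add_mul, Finset.sum_add_distrib]
  map_smul' c a := by
    funext i
    simp only [Pi.smul_apply, smul_eq_mul, RingHom.id_apply, Finset.mul_sum, mul_assoc]

/-- The Fourier coefficient of a word at the frequency `μ`. -/
def freqCoeff (β : K) (n : ℕ) (μ : ℤ) : (Fin n → K) →ₗ[K] K where
  toFun x := ∑ i, x i * β ^ (-(((i : ℕ) : ℤ) * μ))
  map_add' a b := by simp only [Pi.add_apply, add_mul, Finset.sum_add_distrib]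
  map_smul' c a := by
    simp only [Pi.smul_apply, smul_eq_mul, RingHom.id_apply, Finset.mul_sum, mul_assoc]

lemma fourierMap_apply (β : K) (m : ℕ) (a : Fin (2 * m + 1) → K) (i : Fin n) :
    fourierMap β n m a i = ∑ j, a j * β ^ (((i : ℕ) : ℤ) * (((j : ℕ) : ℤ) - m)) := rfl

lemma freqCoeff_apply (β : K) (μ : ℤ) (x : Fin n → K) :
    freqCoeff β n μ x = ∑ i, x i * β ^ (-(((i : ℕ) : ℤ) * μ)) := rfl

variable {β : K} (hβ : IsPrimitiveRoot β n) {m : ℕ}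
include hβ

/-- Up to the factor β^(-im), the entry at i is a polynomial of degree at most 2m evaluated at β^i,
and 2m + 1 distinct nodes give an invertible Vandermonde matrix. -/
lemma fourierMap_eq_zero {T : Finset (Fin n)} (hT : T.card = 2 * m + 1)
    {a : Fin (2 * m + 1) → K} (ha : ∀ i ∈ T, fourierMap β n m a i = 0) : a = 0 := by
  have hn : 0 < n := by
    rcases Nat.eq_zero_or_pos n with rfl | h
    · have : T.card = 0 := by rw [Finset.card_eq_zero]; exact Finset.eq_empty_of_isEmpty T
      omega
    · exact h
  have hβ0 : β ≠ 0 := hβ.ne_zero hn.ne'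
  set g := T.orderIsoOfFin hT with hg
  refine Matrix.eq_zero_of_forall_index_sum_mul_pow_eq_zero
    (f := fun j => β ^ ((g j : Fin n) : ℕ)) ?_ fun j => ?_
  · intro i j hij
    exact g.injective (Subtype.ext (Fin.ext (hβ.pow_inj (g i : Fin n).2 (g j : Fin n).2 hij)))
  · have h1 := ha (g j) (g j).2
    have h3 : fourierMap β n m a (g j) = β ^ (-((((g j : Fin n) : ℕ) : ℤ) * m)) *
        ∑ i : Fin (2 * m + 1), a i * (β ^ ((g j : Fin n) : ℕ)) ^ (i : ℕ) := by
      rw [fourierMap_apply, Finset.mul_sum]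
      refine Finset.sum_congr rfl fun i _ => ?_
      rw [mul_left_comm, ← pow_mul, ← zpow_natCast β, ← zpow_add₀ hβ0]
      congr 2
      push_cast; ring
    rw [h3] at h1
    exact (mul_eq_zero.1 h1).resolve_left (zpow_ne_zero _ hβ0)

lemma exists_fourierMap_eq {T : Finset (Fin n)} (hT : T.card = 2 * m + 1) (y : Fin n → K) :
    ∃ a, ∀ i ∈ T, fourierMap β n m a i = y i := by
  set L : (Fin (2 * m + 1) → K) →ₗ[K] (T → K) :=
    (LinearMap.funLeft K K (fun t : T => (t : Fin n))) ∘ₗ fourierMap β n m with hL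
  have hLapp : ∀ a t, L a t = fourierMap β n m a t := fun _ _ => rfl
  have hinj : Function.Injective L := by
    rw [injective_iff_map_eq_zero]
    intro a ha
    exact fourierMap_eq_zero hβ hT fun i hi => by rw [← hLapp a ⟨i, hi⟩, ha]; rfl
  have hsurj := (LinearMap.injective_iff_surjective_of_finrank_eq_finrank (f := L) (by
    rw [Module.finrank_fin_fun, Module.finrank_fintype_fun_eq_card, Fintype.card_coe, hT])).1 hinj
  obtain ⟨a, ha⟩ := hsurj fun t => y t
  exact ⟨a, fun i hi => congrFun ha ⟨i, hi⟩⟩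

lemma sum_zpow_eq (hn : 0 < n) (μ : ℤ) :
    ∑ i : Fin n, β ^ (((i : ℕ) : ℤ) * μ) = if (n : ℤ) ∣ μ then (n : K) else 0 := by
  have hβ0 : β ≠ 0 := hβ.ne_zero hn.ne'
  have h1 : ∑ i : Fin n, β ^ (((i : ℕ) : ℤ) * μ) = ∑ i ∈ Finset.range n, (β ^ μ) ^ i := by
    rw [Finset.sum_range]
    refine Finset.sum_congr rfl fun i _ => ?_
    rw [← zpow_natCast (β ^ μ), ← zpow_mul, mul_comm]
  rw [h1]
  split_ifs with h
  · rw [(hβ.zpow_eq_one_iff_dvd μ).2 h]; simp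
  · have h3 : β ^ μ - 1 ≠ 0 := fun h0 => h ((hβ.zpow_eq_one_iff_dvd μ).1 (sub_eq_zero.1 h0))
    have h4 := geom_sum_mul (β ^ μ) n
    have h5 : (β ^ μ) ^ n = 1 := by
      rw [← zpow_natCast (β ^ μ), ← zpow_mul, mul_comm, zpow_mul, zpow_natCast, hβ.pow_eq_one,
        one_zpow]
    rw [h5, sub_self] at h4
    exact (mul_eq_zero.1 h4).resolve_right h3

lemma freqCoeff_fourierMap (hn : 0 < n) (a : Fin (2 * m + 1) → K) (μ : ℤ) :
    freqCoeff β n μ (fourierMap β n m a) =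
      ∑ j, a j * if (n : ℤ) ∣ ((j : ℕ) : ℤ) - m - μ then (n : K) else 0 := by
  have hβ0 : β ≠ 0 := hβ.ne_zero hn.ne'
  simp only [freqCoeff_apply, fourierMap_apply, Finset.sum_mul]
  rw [Finset.sum_comm]
  refine Finset.sum_congr rfl fun j _ => ?_
  rw [← sum_zpow_eq hβ hn, Finset.mul_sum]
  refine Finset.sum_congr rfl fun i _ => ?_
  rw [mul_assoc, ← zpow_add₀ hβ0]
  congr 2; ring

lemma freqCoeff_fourierMap_self (hn : 2 * m + 1 ≤ n) (a : Fin (2 * m + 1) → K)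
    (j : Fin (2 * m + 1)) :
    freqCoeff β n (((j : ℕ) : ℤ) - m) (fourierMap β n m a) = a j * n := by
  rw [freqCoeff_fourierMap hβ (by omega), Finset.sum_eq_single j]
  · simp
  · intro i _ hij
    rw [if_neg, mul_zero]
    intro h
    have hi := i.2
    have hj := j.2
    have h0 := Int.eq_zero_of_abs_lt_dvd h (by rw [abs_lt]; constructor <;> omega)
    exact hij (Fin.ext (by omega))
  · simp

lemma freqCoeff_fourierMap_eq_zero (hn : 0 < n) {a : Fin (2 * m + 1) → K} {μ : ℤ}
    (h : ∀ j : Fin (2 * m + 1), (n : ℤ) ∣ ((j : ℕ) : ℤ) - m - μ → a j = 0) :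
    freqCoeff β n μ (fourierMap β n m a) = 0 := by
  rw [freqCoeff_fourierMap hβ hn]
  refine Finset.sum_eq_zero fun j _ => ?_
  split_ifs with hj
  · rw [h j hj, zero_mul]
  · rw [mul_zero]

end fourier

/-! ### Descent to F and the rank of the Hermitian form -/

section fourierCode

variable {F K : Type*} [Field F] [Field K] [Algebra F K] {n : ℕ}

/-- The words over `F` with Fourier support in `[-m, m]`. -/
def fourierCode (F : Type*) {K : Type*} [Field F] [Field K] [Algebra F K] (β : K) (n m : ℕ) :
    Submodule F (Fin n → F) where
  carrier := {x | ∃ a, ∀ i, algebraMap F K (x i) = fourierMap β n m a i}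
  add_mem' := by
    rintro x y ⟨a, ha⟩ ⟨b, hb⟩
    exact ⟨a + b, fun i => by rw [map_add, Pi.add_apply, Pi.add_apply, map_add, ha, hb]⟩
  zero_mem' := ⟨0, fun i => by simp⟩
  smul_mem' := by
    rintro c x ⟨a, ha⟩
    exact ⟨algebraMap F K c • a, fun i => by
      rw [map_smul, Pi.smul_apply, Pi.smul_apply, smul_eq_mul, smul_eq_mul, map_mul, ha]⟩

variable {β : K} {m : ℕ} {τ : K →+* K}

/-- Galois descent: τ inverts β, so it maps the interpolating word to the one with reversed,
conjugated coefficients. Both interpolate the same F-valued data, so by uniqueness the word is fixed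
by τ. -/
lemma exists_mem_fourierCode (hβ : IsPrimitiveRoot β n) (hτβ : τ β = β⁻¹)
    (hτF : ∀ x : F, τ (algebraMap F K x) = algebraMap F K x)
    (hτ : ∀ x, τ x = x → ∃ y : F, algebraMap F K y = x)
    {T : Finset (Fin n)} (hT : T.card = 2 * m + 1) (y : Fin n → F) :
    ∃ s ∈ fourierCode F β n m, ∀ i ∈ T, s i = y i := by
  obtain ⟨a, ha⟩ := exists_fourierMap_eq hβ hT fun i => algebraMap F K (y i)
  set a' : Fin (2 * m + 1) → K := fun j => τ (a j.rev) with ha'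
  have hτE : ∀ i, τ (fourierMap β n m a i) = fourierMap β n m a' i := by
    intro i
    rw [fourierMap_apply, fourierMap_apply, map_sum]
    refine Fintype.sum_equiv Fin.revPerm _ _ fun j => ?_
    rw [map_mul, map_zpow₀, hτβ, inv_zpow', ha']
    simp only [Fin.revPerm_apply, Fin.rev_rev]
    congr 2
    have := j.2
    rw [Fin.val_rev]
    push_cast [Nat.sub_add_comm]
    rw [Nat.cast_sub (by omega)]
    push_cast
    ring
  have haa : a' = a := by
    rw [← sub_eq_zero]
    refine fourierMap_eq_zero hβ hT fun i hi => ?_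
    rw [map_sub, Pi.sub_apply, ← hτE, ha i hi, hτF, sub_self]
  have hx : ∀ i, ∃ x : F, algebraMap F K x = fourierMap β n m a i := fun i =>
    hτ _ (by rw [hτE, haa])
  choose x hx using hx
  exact ⟨x, ⟨a, hx⟩, fun i hi => (algebraMap F K).injective (by rw [hx, ha i hi])⟩

lemma exists_isSystematic_fourierCode (hβ : IsPrimitiveRoot β n) (hτβ : τ β = β⁻¹)
    (hτF : ∀ x : F, τ (algebraMap F K x) = algebraMap F K x)
    (hτ : ∀ x, τ x = x → ∃ y : F, algebraMap F K y = x)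
    {T : Finset (Fin n)} (hT : T.card = 2 * m + 1) :
    ∃ b, IsSystematic (fourierCode F β n m) T b := by
  choose b hb hbT using fun t : Fin n =>
    exists_mem_fourierCode hβ hτβ hτF hτ hT (Pi.single t (1 : F))
  refine ⟨b, hb, fun t _ i hi => by rw [hbT t i hi, Pi.single_apply], ?_⟩
  rintro s ⟨a, ha⟩ hs
  have h0 : a = 0 := fourierMap_eq_zero hβ hT fun i hi => by rw [← ha, hs i hi, map_zero]
  funext i
  apply (algebraMap F K).injective
  rw [ha, h0, map_zero, Pi.zero_apply, Pi.zero_apply, map_zero]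

/-- Over `K`, the words with Fourier support in `[-m, m]` are combinations of words over `F`. -/
lemma fourierMap_eq_sum (hβ : IsPrimitiveRoot β n) {T : Finset (Fin n)}
    (hT : T.card = 2 * m + 1) {b : Fin n → Fin n → F}
    (hb : IsSystematic (fourierCode F β n m) T b) (a : Fin (2 * m + 1) → K) :
    fourierMap β n m a =
      ∑ t ∈ T, fourierMap β n m a t • (fun i => algebraMap F K (b t i)) := by
  choose f hf using hb.mem
  have hbf : ∀ t, (fun i => algebraMap F K (b t i)) = fourierMap β n m (f t) := fun t =>
    funext (hf t)
  simp only [hbf]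
  rw [← sub_eq_zero]
  simp only [← map_smul, ← map_sum, ← map_sub]
  have h0 : a - ∑ t ∈ T, fourierMap β n m a t • f t = 0 := by
    refine fourierMap_eq_zero hβ hT fun i hi => ?_
    rw [map_sub, map_sum, Pi.sub_apply, Finset.sum_apply, Finset.sum_eq_single i]
    · rw [map_smul, Pi.smul_apply, ← hf, hb.apply i hi i hi, if_pos rfl]
      simp
    · intro t ht hti
      rw [map_smul, Pi.smul_apply, ← hf, hb.apply t ht i hi, if_neg (Ne.symm hti)]
      simp
    · exact fun h => absurd hi h
  rw [h0, map_zero]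

open Classical in
/-- The frequencies in `[-m, m]` that also lie in `q [-m, m]` modulo `n`. -/
noncomputable def selfPairedFreq (q n m : ℕ) : Finset (Fin (2 * m + 1)) :=
  Finset.univ.filter fun j => ∃ l : Fin (2 * m + 1),
    (n : ℤ) ∣ q * (((j : ℕ) : ℤ) - m) + (((l : ℕ) : ℤ) - m)

lemma cast_rev_sub (j : Fin (2 * m + 1)) :
    (((j.rev : Fin (2 * m + 1)) : ℕ) : ℤ) - m = -(((j : ℕ) : ℤ) - m) := by
  have := j.2
  rw [Fin.val_rev]
  omega

variable {q : ℕ} {σ : F →+* F} {σK : K →+* K}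

/-- The rank of the Hermitian form on the code: the length of an orthogonal basis of a complement
of the radical. -/
theorem card_orthogonal_family_fourierCode (hβ : IsPrimitiveRoot β n) (hτβ : τ β = β⁻¹)
    (hτF : ∀ x : F, τ (algebraMap F K x) = algebraMap F K x)
    (hτ : ∀ x, τ x = x → ∃ y : F, algebraMap F K y = x)
    (hσK : ∀ x : F, σK (algebraMap F K x) = algebraMap F K (σ x)) (hσβ : σK β = β ^ q)
    (hq : (n : ℤ) ∣ q * q + 1) (hm : 2 * m + 1 ≤ n) (hnK : (n : K) ≠ 0)
    {c : ℕ} {u : Fin c → Fin n → F} (huS : ∀ i, u i ∈ fourierCode F β n m)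
    (huu : ∀ i j, i ≠ j → hermForm σ (u i) (u j) = 0) (hu0 : ∀ i, hermForm σ (u i) (u i) ≠ 0)
    (hdec : ∀ s ∈ fourierCode F β n m, ∃ a : Fin c → F,
      ∃ r ∈ fourierCode F β n m ⊓ hermDual σ (fourierCode F β n m), s = r + ∑ i, a i • u i) :
    c = (selfPairedFreq q n m).card := by
  classical
  obtain ⟨T, -, hT⟩ := Finset.exists_subset_card_eq
    (s := (Finset.univ : Finset (Fin n))) (n := 2 * m + 1) (by simpa using hm)
  obtain ⟨b, hb⟩ := exists_isSystematic_fourierCode hβ hτβ hτF hτ hT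
  have hn : 0 < n := by omega
  have hβ0 : β ≠ 0 := hβ.ne_zero hn.ne'
  set ι : (Fin n → F) → Fin n → K := fun x i => algebraMap F K (x i) with hι
  set J := selfPairedFreq q n m with hJ
  have hmemJ : ∀ j, j ∈ J ↔ ∃ l : Fin (2 * m + 1),
      (n : ℤ) ∣ q * (((j : ℕ) : ℤ) - m) + (((l : ℕ) : ℤ) - m) := fun j => by
    simp [hJ, selfPairedFreq]
  have hσpow : ∀ (i : ℕ) (μ : ℤ), σK (β ^ ((i : ℤ) * μ)) = β ^ (-((i : ℤ) * (-(q * μ)))) := by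
    intro i μ
    rw [map_zpow₀, hσβ, ← zpow_natCast β, ← zpow_mul]
    congr 1; ring
  have hιsum : ∀ {s : Finset (Fin c)} (a : Fin c → F),
      ι (∑ i ∈ s, a i • u i) = ∑ i ∈ s, algebraMap F K (a i) • ι (u i) := by
    intro s a
    funext l
    simp only [hι, Finset.sum_apply, map_sum, Pi.smul_apply, smul_eq_mul, map_mul]
  -- If n ∣ qj + l, then j ≡ ql because q² ≡ -1. The coefficient of r at j is thus its Hermitian
  -- pairing with the pure frequency -l, which is a K-combination of words of the code.
  have hrad : ∀ r ∈ hermDual σ (fourierCode F β n m), ∀ j ∈ J,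
      freqCoeff β n (((j : ℕ) : ℤ) - m) (ι r) = 0 := by
    intro r hr j hj
    obtain ⟨l, hl⟩ := (hmemJ j).1 hj
    set z := fourierMap β n m (Pi.single l.rev 1) with hz
    have hzi : ∀ i, z i = β ^ (((i : ℕ) : ℤ) * (-(((l : ℕ) : ℤ) - m))) := by
      intro i
      rw [hz, fourierMap_apply, Finset.sum_eq_single l.rev]
      · rw [cast_rev_sub]; simp
      · intro k _ hk; simp [hk]
      · simp
    have hzr : ∑ i, σK (z i) * ι r i = 0 := by
      have hexp := fourierMap_eq_sum hβ hT hb (Pi.single l.rev 1)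
      rw [← hz] at hexp
      have : ∀ i, σK (z i) = ∑ t ∈ T, σK (z t) * algebraMap F K (σ (b t i)) := by
        intro i
        conv_lhs => rw [hexp]
        simp only [Finset.sum_apply, Pi.smul_apply, smul_eq_mul, map_sum, map_mul, hσK]
      rw [Finset.sum_congr rfl fun i _ => congrArg (· * ι r i) (this i)]
      simp only [Finset.sum_mul]
      rw [Finset.sum_comm]
      refine Finset.sum_eq_zero fun t _ => ?_
      have h3 := hr _ (hb.mem t)
      rw [hermForm] at h3
      have h4 := congrArg (algebraMap F K) h3
      simp only [map_sum, map_mul, map_zero] at h4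
      simp only [mul_assoc, ← Finset.mul_sum]
      rw [h4, mul_zero]
    rw [freqCoeff_apply, ← hzr]
    refine Finset.sum_congr rfl fun i _ => ?_
    rw [hzi, hσpow, mul_comm]
    congr 1
    rw [← div_eq_one_iff_eq (zpow_ne_zero _ hβ0), ← zpow_sub₀ hβ0, hβ.zpow_eq_one_iff_dvd]
    have h5 : (n : ℤ) ∣ ((j : ℕ) : ℤ) - m - q * (((l : ℕ) : ℤ) - m) := by
      have h6 := (hq.mul_right (((j : ℕ) : ℤ) - m)).sub (hl.mul_left (q : ℤ))
      refine h6.trans (dvd_of_eq ?_)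
      ring
    refine (h5.mul_left (-((i : ℕ) : ℤ))).trans (dvd_of_eq ?_)
    ring
  -- The count c = |J| comes from showing that the J-coefficients are coordinates on the K-span of
  -- u. The passage to K is what allows pure frequencies to be used.
  set Φ : (Fin c → K) →ₗ[K] (J → K) :=
    LinearMap.pi (fun j : J => freqCoeff β n ((((j : Fin (2 * m + 1)) : ℕ) : ℤ) - m) ∘ₗ
      Fintype.linearCombination K fun i => ι (u i)) with hΦ
  have hΦapp : ∀ κ j, Φ κ j = freqCoeff β n ((((j : Fin (2 * m + 1)) : ℕ) : ℤ) - m)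
      (∑ i, κ i • ι (u i)) := fun _ _ => rfl
  choose f hf using huS
  have hιf : ∀ i, ι (u i) = fourierMap β n m (f i) := fun i => funext (hf i)
  have hinj : Function.Injective Φ := by
    rw [injective_iff_map_eq_zero]
    intro κ hκ
    set y := ∑ i, κ i • ι (u i) with hy
    set g := ∑ i, κ i • f i with hg
    have hyg : y = fourierMap β n m g := by
      rw [hy, hg, map_sum]
      exact Finset.sum_congr rfl fun i _ => by rw [map_smul, hιf]
    have hg0 : ∀ j ∈ J, g j = 0 := by
      intro j hj
      have h1 : freqCoeff β n (((j : ℕ) : ℤ) - m) y = 0 := by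
        have := congrFun hκ ⟨j, hj⟩
        rwa [hΦapp] at this
      rw [hyg, freqCoeff_fourierMap_self hβ hm] at h1
      exact (mul_eq_zero.1 h1).resolve_right hnK
    funext j
    -- Every frequency l of u j reads off the coefficient of y at -ql, and any frequency of the
    -- interval congruent to it lies in J, where y vanishes.
    have hpair : ∑ i, σK (ι (u j) i) * y i = 0 := by
      rw [hιf]
      simp only [fourierMap_apply, map_sum, Finset.sum_mul, map_mul, hσpow]
      rw [Finset.sum_comm]
      refine Finset.sum_eq_zero fun l _ => ?_
      have h1 : freqCoeff β n (-(q * (((l : ℕ) : ℤ) - m))) y = 0 := by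
        rw [hyg]
        refine freqCoeff_fourierMap_eq_zero hβ hn fun k hk => hg0 k ((hmemJ k).2 ⟨l.rev, ?_⟩)
        rw [cast_rev_sub]
        have h6 := (hk.mul_left (q : ℤ)).sub (hq.mul_right (((l : ℕ) : ℤ) - m))
        refine h6.trans (dvd_of_eq ?_)
        ring
      rw [freqCoeff_apply] at h1
      rw [← mul_zero (σK (f j l)), ← h1, Finset.mul_sum]
      exact Finset.sum_congr rfl fun i _ => by ring
    have hpair' : ∑ i, σK (ι (u j) i) * y i =
        κ j * algebraMap F K (hermForm σ (u j) (u j)) := by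
      have h1 : ∀ i, y i = ∑ l, κ l * algebraMap F K (u l i) := fun i => by
        rw [hy, Finset.sum_apply]; rfl
      simp only [h1, Finset.mul_sum]
      rw [Finset.sum_comm, Finset.sum_eq_single j]
      · rw [hermForm, map_sum, Finset.mul_sum]
        refine Finset.sum_congr rfl fun i _ => ?_
        rw [map_mul, ← hσK]; ring
      · intro l _ hl
        have h3 := congrArg (algebraMap F K) (huu j l (Ne.symm hl))
        rw [hermForm, map_sum, map_zero] at h3
        rw [← mul_zero (κ l), ← h3, Finset.mul_sum]
        refine Finset.sum_congr rfl fun i _ => ?_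
        rw [map_mul, ← hσK]; ring
      · simp
    rw [hpair] at hpair'
    refine (mul_eq_zero.1 hpair'.symm).resolve_right fun h => hu0 j ?_
    exact (algebraMap F K).injective (by rw [h, map_zero])
  have hsurj : Function.Surjective Φ := by
    intro t
    -- The word with prescribed coefficients on J is expanded in the code; dropping the radical
    -- components leaves its J-coefficients unchanged by `hrad`.
    set g : Fin (2 * m + 1) → K := fun j => if hj : j ∈ J then t ⟨j, hj⟩ / n else 0 with hg
    choose a r hr hbr using fun t => hdec (b t) (hb.mem t)
    set y := fourierMap β n m g with hy
    refine ⟨∑ s ∈ T, y s • fun i => algebraMap F K (a s i), funext fun j => ?_⟩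
    have h1 : freqCoeff β n ((((j : Fin (2 * m + 1)) : ℕ) : ℤ) - m) y = t j := by
      rw [hy, freqCoeff_fourierMap_self hβ hm, hg]
      simp [hnK]
    have hyy : y = ∑ s ∈ T, y s • fun i => algebraMap F K (b s i) := fourierMap_eq_sum hβ hT hb g
    have h3 : ∑ i, (∑ s ∈ T, y s • fun i => algebraMap F K (a s i)) i • ι (u i) =
        ∑ s ∈ T, y s • ∑ i, algebraMap F K (a s i) • ι (u i) := by
      simp only [Finset.sum_apply, Pi.smul_apply, smul_eq_mul, Finset.sum_smul, Finset.smul_sum,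
        smul_smul]
      rw [Finset.sum_comm]
    rw [← h1, hΦapp, h3, map_sum]
    conv_rhs => rw [hyy, map_sum]
    refine Finset.sum_congr rfl fun s _ => ?_
    rw [map_smul, map_smul, ← hιsum]
    congr 1
    have h4 : (fun i => algebraMap F K (b s i)) = ι (r s) + ι (∑ i, a s i • u i) := by
      funext i
      rw [hbr s]
      simp [hι]
    rw [h4, map_add, hrad _ (hr s).2 j j.2, zero_add]
  have := (LinearEquiv.ofBijective Φ ⟨hinj, hsurj⟩).finrank_eq
  rwa [Module.finrank_fin_fun, Module.finrank_fintype_fun_eq_card, Fintype.card_coe] at this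

end fourierCode

/-! ### The fields with q and q² elements -/

section fields

lemma exists_algebraMap_eq_of_pow_card {F K : Type*} [Field F] [Fintype F] [Field K] [Algebra F K]
    {x : K} (hx : x ^ Fintype.card F = x) : ∃ y : F, algebraMap F K y = x := by
  classical
  have h1 : 1 < Fintype.card F := Fintype.one_lt_card
  have hne : (X ^ Fintype.card F - X : K[X]) ≠ 0 := FiniteField.X_pow_card_sub_X_ne_zero K h1
  have hsub : Finset.univ.image (algebraMap F K) ⊆
      (X ^ Fintype.card F - X : K[X]).roots.toFinset := by
    intro z hz
    obtain ⟨y, -, rfl⟩ := Finset.mem_image.1 hz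
    rw [Multiset.mem_toFinset, mem_roots hne, IsRoot.def]
    simp [← map_pow, FiniteField.pow_card]
  have hcard : (X ^ Fintype.card F - X : K[X]).roots.toFinset.card ≤
      (Finset.univ.image (algebraMap F K)).card := by
    rw [Finset.card_image_of_injective _ (algebraMap F K).injective, Finset.card_univ]
    refine (Multiset.toFinset_card_le _).trans ((card_roots' _).trans ?_)
    rw [FiniteField.X_pow_card_sub_X_natDegree_eq K h1]
  have hmem : x ∈ (X ^ Fintype.card F - X : K[X]).roots.toFinset := by
    rw [Multiset.mem_toFinset, mem_roots hne, IsRoot.def]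
    simp [hx]
  rw [← Finset.eq_of_subset_of_card_le hsub hcard] at hmem
  obtain ⟨y, -, hy⟩ := Finset.mem_image.1 hmem
  exact ⟨y, hy⟩

/-- If a field has `q ^ 2` elements, then `q` is a power of the characteristic. -/
lemma exists_eq_prime_pow {F : Type*} [Field F] [Fintype F] {q : ℕ}
    (hF : Fintype.card F = q ^ 2) : ∃ p e : ℕ, p.Prime ∧ CharP F p ∧ e ≠ 0 ∧ q = p ^ e := by
  obtain ⟨p, hp⟩ := CharP.exists F
  obtain ⟨k, hpp, hk⟩ := FiniteField.card F p
  obtain ⟨e, -, he⟩ := (Nat.dvd_prime_pow hpp).1 ((dvd_pow_self q two_ne_zero).trans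
    (dvd_of_eq (hF.symm.trans hk)))
  refine ⟨p, e, hpp, hp, ?_, he⟩
  rintro rfl
  have := Fintype.one_lt_card (α := F)
  rw [hF, he] at this
  simp at this

/-- `Fin q` carries a field structure that embeds into a given field with `q ^ 2` elements. -/
lemma exists_field_fin {F : Type*} [Field F] [Fintype F] {q : ℕ}
    (hF : Fintype.card F = q ^ 2) : ∃ _ : Field (Fin q), Nonempty (Fin q →+* F) := by
  obtain ⟨p, e, hp, hchar, he, rfl⟩ := exists_eq_prime_pow hF
  have := Fact.mk hp
  let : Algebra (ZMod p) F := ZMod.algebra F p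
  have hcard : Nat.card (GaloisField p e) = p ^ e := GaloisField.card p e he
  have hfr : Module.finrank (ZMod p) F = e * 2 := by
    have h := FiniteField.pow_finrank_eq_card p F
    rw [hF, ← pow_mul] at h
    exact Nat.pow_right_injective hp.two_le h
  obtain ⟨f⟩ := FiniteField.nonempty_algHom_of_finrank_dvd (F := ZMod p)
    (K := GaloisField p e) (L := F) (by rw [hfr, GaloisField.finrank p he]; exact dvd_mul_right _ _)
  have : Finite (GaloisField p e) := Nat.finite_of_card_ne_zero (by
    rw [hcard]; exact pow_ne_zero _ hp.ne_zero)
  have eq : Fin (p ^ e) ≃ GaloisField p e :=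
    (finCongr hcard.symm).trans (Finite.equivFin (GaloisField p e)).symm
  let : Field (Fin (p ^ e)) := eq.field
  exact ⟨inferInstance, ⟨f.toRingHom.comp (eq.ringEquiv : Fin (p ^ e) →+* GaloisField p e)⟩⟩

end fields

/-- The entanglement-assisted code of the Hermitian dual of the Fourier code. -/
theorem existsEAQECC_of_fourierCode {F K : Type*} [Field F] [Fintype F] [Field K] [Algebra F K]
    {q n m c k : ℕ} (hF : Fintype.card F = q ^ 2) (hq2 : Odd q) {β : K}
    (hβ : IsPrimitiveRoot β n) (hn : n ∣ q ^ 2 + 1) (hm : 2 * m + 1 ≤ n)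
    (hc : (selfPairedFreq q n m).card = c) (hk : k + (4 * m + 2) = n + c) (hk1 : 1 ≤ k) :
    ExistsEAQECC q n k (2 * m + 2) c := by
  refine ⟨hk1, ?_⟩
  obtain ⟨p, e, hp, hchar, he, hqe⟩ := exists_eq_prime_pow hF
  obtain ⟨hA, ⟨fA⟩⟩ := exists_field_fin hF
  let : Algebra (Fin q) F := fA.toAlgebra
  have hA' : Fintype.card (Fin q) = q := Fintype.card_fin q
  have := Fact.mk hp
  have : CharP K p := charP_of_injective_algebraMap (algebraMap F K).injective p
  set σ : F →+* F := iterateFrobenius F p e with hσdef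
  set σK : K →+* K := iterateFrobenius K p e with hσKdef
  set τ : K →+* K := iterateFrobenius K p (e * 2) with hτdef
  have hσx : ∀ x, σ x = x ^ q := fun x => by rw [hσdef, iterateFrobenius_def, hqe]
  have hσKx : ∀ x, σK x = x ^ q := fun x => by rw [hσKdef, iterateFrobenius_def, hqe]
  have hτx : ∀ x, τ x = x ^ (q ^ 2) := fun x => by
    rw [hτdef, iterateFrobenius_def, hqe, pow_mul]
  have hσ : ∀ x, σ (σ x) = x := fun x => by
    rw [hσx, hσx, ← pow_mul, ← sq, ← hF, FiniteField.pow_card]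
  have hσA : ∀ a : Fin q, σ (algebraMap (Fin q) F a) = algebraMap (Fin q) F a := fun a => by
    rw [hσx, ← map_pow]
    congr 1
    have := FiniteField.pow_card a
    rwa [hA'] at this
  have hfix : ∀ x, σ x = x → ∃ a : Fin q, algebraMap (Fin q) F a = x := fun x hx =>
    exists_algebraMap_eq_of_pow_card (by rw [hA', ← hσx, hx])
  have h2 : (2 : F) ≠ 0 := by
    intro h
    have h1 : p ∣ 2 := (CharP.cast_eq_zero_iff F p 2).1 (by exact_mod_cast h)
    have h3 : p = 2 := (Nat.prime_dvd_prime_iff_eq hp Nat.prime_two).1 h1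
    rw [hqe, h3] at hq2
    exact (Nat.not_odd_iff_even.2 ((even_two).pow_of_ne_zero he)) hq2
  obtain ⟨ε, hε, hσε⟩ : ∃ ε : F, ε ≠ 0 ∧ σ ε = -ε := by
    -- Without such an ε, every x - σx would vanish, so σ would be the identity and F would have at
    -- most q elements.
    by_contra! h
    have hall : ∀ x, σ x = x := fun x => by
      by_contra hx
      refine h (x - σ x) (sub_ne_zero.2 (Ne.symm hx)) ?_
      rw [map_sub, hσ, neg_sub]
    have hle : Fintype.card F ≤ Fintype.card (Fin q) :=
      Fintype.card_le_of_surjective _ fun x => hfix x (hall x)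
    rw [hF, hA'] at hle
    have : 1 < Fintype.card (Fin q) := Fintype.one_lt_card
    rw [hA'] at this
    nlinarith
  have hτβ : τ β = β⁻¹ := by
    refine eq_inv_of_mul_eq_one_left ?_
    rw [hτx, ← pow_succ, hβ.pow_eq_one_iff_dvd]
    exact hn
  have hτF : ∀ x : F, τ (algebraMap F K x) = algebraMap F K x := fun x => by
    rw [hτx, ← map_pow, ← hF, FiniteField.pow_card]
  have hτ : ∀ x, τ x = x → ∃ y : F, algebraMap F K y = x := fun x hx =>
    exists_algebraMap_eq_of_pow_card (by rw [hF, ← hτx, hx])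
  have hσK : ∀ x : F, σK (algebraMap F K x) = algebraMap F K (σ x) := fun x => by
    rw [hσKx, hσx, map_pow]
  have hnK : (n : K) ≠ 0 := by
    intro h
    obtain ⟨l, hl⟩ := hn
    have hqK : (q : K) = 0 := by
      rw [hqe, Nat.cast_pow, CharP.cast_eq_zero, zero_pow he]
    have := congrArg (Nat.cast : ℕ → K) hl
    push_cast at this
    rw [h, hqK] at this
    simp at this
  have hqn : (n : ℤ) ∣ q * q + 1 := by
    rw [← sq]; exact_mod_cast hn
  obtain ⟨T, -, hT⟩ := Finset.exists_subset_card_eq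
    (s := (Finset.univ : Finset (Fin n))) (n := 2 * m + 1) (by simpa using hm)
  obtain ⟨b, hb⟩ := exists_isSystematic_fourierCode hβ hτβ hτF hτ hT
  set S := fourierCode F β n m with hS
  set D := hermDual σ S with hD
  obtain ⟨c', u, hu, huu, hu0, hudec⟩ := exists_orthogonal_family hσ h2 S
  obtain ⟨k', w, hw, hww, hw0, hwdec'⟩ := exists_orthogonal_family hσ h2 D
  have hwdec : ∀ x ∈ D, ∃ a : Fin k' → F, ∃ r ∈ S ⊓ D, x = r + ∑ i, a i • w i := by
    intro x hx
    obtain ⟨a, r, hr, h⟩ := hwdec' x hx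
    exact ⟨a, r, ⟨hb.mem_of_dual hσ hr.2, hr.1⟩, h⟩
  have hc' := card_orthogonal_family_fourierCode hβ hτβ hτF hτ hσK (hσKx β) hqn hm hnK hu huu hu0
    hudec
  have hfS := finrank_eq_of_orthogonal_family (R := S ⊓ D) inf_le_left
    (fun x hx r hr => hr.2 x hx) hu huu hu0 hudec
  have hfD := finrank_eq_of_orthogonal_family (R := S ⊓ D) inf_le_right
    (fun x hx r hr => hermForm_eq_zero_swap hσ (hx r hr.1)) hw hww hw0 hwdec
  have hS1 := hb.finrank_eq
  have hD1 : Module.finrank F D + T.card = n := hb.finrank_hermDual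
  rw [hT] at hS1 hD1
  obtain rfl : c' = c := hc'.trans hc
  obtain rfl : k' = k := by omega
  -- As k ≥ 1 there is an anisotropic vector w 0 in D; inside S it would be orthogonal to itself.
  have hDS : ¬ D ≤ S := fun h => by
    have h0 : hermForm σ (w ⟨0, hk1⟩) (w ⟨0, hk1⟩) = 0 := hw ⟨0, hk1⟩ _ (h (hw ⟨0, hk1⟩))
    exact hw0 _ h0
  obtain ⟨i, hi, hiS⟩ := hb.exists_dualWord_notMem hDS
  refine exists_isEAQECC_of_orthogonal hσ hσA hfix hε hσε h2 S D (fun s hs x hx => hx s hs) u w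
    hu hw huu hu0 hww hw0 hudec hwdec ?_ (insert i T) (by rw [Finset.card_insert_of_notMem hi, hT])
    (dualWord σ T b i) (hb.dualWord_mem i) hiS ?_
  · intro T' hT' y
    obtain ⟨T'', hsub, -, hT''⟩ := Finset.exists_subsuperset_card_eq (Finset.subset_univ T')
      (n := 2 * m + 1) (by omega) (by simpa using hm)
    obtain ⟨s, hs, hsy⟩ := exists_mem_fourierCode hβ hτβ hτF hτ hT'' y
    exact ⟨s, hs, fun i hi => hsy i (hsub hi)⟩
  · intro l hl
    rw [Finset.mem_insert, not_or] at hl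
    rw [dualWord_apply_of_notMem hl.2]
    simp [hl.1]

/-- For `q = 10 t + 3`, the lattice `{(a, b) | n ∣ q a + b}` is spanned by `(t, 3 t + 1)` and
`(3 t + 1, -t)`, and has nine points in the square `[-m, m]²`. -/
lemma card_selfPairedFreq {t m : ℕ} (ht : 1 ≤ t) (hm : 4 * t + 1 ≤ m) (hm' : m ≤ 5 * t) :
    (selfPairedFreq (10 * t + 3) (10 * t ^ 2 + 6 * t + 1) m).card = 9 := by
  classical
  have hinj : Function.Injective fun j : Fin (2 * m + 1) => ((j : ℕ) : ℤ) - m := by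
    intro i j h
    exact Fin.ext (by simpa using h)
  rw [← Finset.card_image_of_injective _ hinj]
  have himg : (selfPairedFreq (10 * t + 3) (10 * t ^ 2 + 6 * t + 1) m).image
      (fun j : Fin (2 * m + 1) => ((j : ℕ) : ℤ) - m) =
      (Finset.Icc (-1 : ℤ) 1 ×ˢ Finset.Icc (-1 : ℤ) 1).image
        fun p : ℤ × ℤ => p.1 * (t : ℤ) + p.2 * (3 * t + 1) := by
    ext a
    simp only [Finset.mem_image, selfPairedFreq, Finset.mem_filter, Finset.mem_univ, true_and,
      Finset.mem_product, Finset.mem_Icc, Prod.exists]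
    constructor
    · rintro ⟨j, ⟨l, z, hz⟩, rfl⟩
      have hj := j.2
      have hl := l.2
      obtain ⟨a, ha⟩ : ∃ a : ℤ, a = ((j : ℕ) : ℤ) - m := ⟨_, rfl⟩
      obtain ⟨b, hb⟩ : ∃ b : ℤ, b = ((l : ℕ) : ℤ) - m := ⟨_, rfl⟩
      rw [← ha, ← hb] at hz
      rw [← ha]
      push_cast at hz
      obtain ⟨T, hT⟩ : ∃ T : ℤ, T = (t : ℤ) := ⟨_, rfl⟩
      rw [← hT] at hz ⊢
      have hT1 : 1 ≤ T := by omega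
      have ha1 : a ≤ 5 * T := by omega
      have ha2 : -(5 * T) ≤ a := by omega
      have hb1 : b ≤ 5 * T := by omega
      have hb2 : -(5 * T) ≤ b := by omega
      -- The two spanning vectors are orthogonal of squared length n, so n times a coordinate is an
      -- inner product, at most 5T(4T + 1) = 20T² + 5T in absolute value. This is less than 2n, so
      -- the coordinates lie in {-1, 0, 1}.
      have hx : (10 * T ^ 2 + 6 * T + 1) * ((3 * T + 1) * z - 3 * a) = T * a + (3 * T + 1) * b := by
        linear_combination (-(3 * T + 1)) * hz
      have hy : (10 * T ^ 2 + 6 * T + 1) * (a - T * z) = (3 * T + 1) * a - T * b := by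
        linear_combination T * hz
      have e1 := mul_le_mul_of_nonneg_left ha1 (by omega : (0 : ℤ) ≤ T)
      have e2 := mul_le_mul_of_nonneg_left ha2 (by omega : (0 : ℤ) ≤ T)
      have e3 := mul_le_mul_of_nonneg_left hb1 (by omega : (0 : ℤ) ≤ T)
      have e4 := mul_le_mul_of_nonneg_left hb2 (by omega : (0 : ℤ) ≤ T)
      have hN : (0 : ℤ) < 10 * T ^ 2 + 6 * T + 1 := by positivity
      have key : ∀ x : ℤ, (10 * T ^ 2 + 6 * T + 1) * x ≤ 20 * T ^ 2 + 5 * T →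
          -(20 * T ^ 2 + 5 * T) ≤ (10 * T ^ 2 + 6 * T + 1) * x → -1 ≤ x ∧ x ≤ 1 := by
        intro x h1 h2
        constructor
        · by_contra! h
          have := mul_le_mul_of_nonneg_left (by omega : x ≤ -2) hN.le
          linarith
        · by_contra! h
          have := mul_le_mul_of_nonneg_left (by omega : 2 ≤ x) hN.le
          linarith
      refine ⟨(3 * T + 1) * z - 3 * a, a - T * z, ⟨key _ ?_ ?_, key _ ?_ ?_⟩, by ring⟩
      · rw [hx]; linarith
      · rw [hx]; linarith
      · rw [hy]; linarith
      · rw [hy]; linarith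
    · rintro ⟨x, y, ⟨⟨hx1, hx2⟩, hy1, hy2⟩, rfl⟩
      have hbd : ∀ x y : ℤ, -1 ≤ x → x ≤ 1 → -1 ≤ y → y ≤ 1 →
          -(m : ℤ) ≤ x * t + y * (3 * t + 1) ∧ x * t + y * (3 * t + 1) ≤ m := by
        intro x y h1 h2 h3 h4
        interval_cases x <;> interval_cases y <;> constructor <;> omega
      obtain ⟨h1, h2⟩ := hbd x y hx1 hx2 hy1 hy2
      obtain ⟨h3, h4⟩ := hbd (-y) x (by omega) (by omega) hx1 hx2
      -- The quotient is x + 3y because qt + (3t + 1) = n and q(3t + 1) - t = 3n. The bound m ≥ 4t +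
      -- 1 is what puts all nine points in the square.
      refine ⟨⟨(x * t + y * (3 * t + 1) + m).toNat, by omega⟩,
        ⟨⟨(-y * t + x * (3 * t + 1) + m).toNat, by omega⟩, x + 3 * y, ?_⟩, ?_⟩
      · simp only
        rw [Int.toNat_of_nonneg (by omega), Int.toNat_of_nonneg (by omega)]
        push_cast
        ring
      · simp only
        rw [Int.toNat_of_nonneg (by omega)]
        ring
  rw [himg, Finset.card_image_of_injOn]
  · rfl
  · rintro ⟨x, y⟩ h ⟨x', y'⟩ h' he
    simp only [Finset.coe_product, Finset.coe_Icc, Set.mem_prod, Set.mem_Icc] at h h' he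
    obtain ⟨⟨h1, h2⟩, h3, h4⟩ := h
    obtain ⟨⟨h5, h6⟩, h7, h8⟩ := h'
    rw [Prod.mk.injEq]
    interval_cases x <;> interval_cases y <;> interval_cases x' <;> interval_cases y' <;>
      constructor <;> omega

/-! ### Existence of constacyclic codes -/

section constacyclic

variable {F K : Type*} [Field F] [Field K] [Algebra F K] {n : ℕ}

/-- The shift is multiplication by x modulo x^n - α; the correction term removes the overflowing
leading coefficient. -/
lemma wordPoly_constacyclicShift (α : F) (c : Fin (n + 1) → F) :
    wordPoly (constacyclicShift α c) =
      X * wordPoly c - C (c (Fin.last n)) * (X ^ (n + 1) - C α) := by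
  have h1 : wordPoly (constacyclicShift α c) =
      C (α * c (Fin.last n)) + ∑ i : Fin n, C (c i.castSucc) * X ^ ((i : ℕ) + 1) := by
    rw [wordPoly, Fin.sum_univ_succ]
    congr 1
    simp [constacyclicShift, Fin.last]
  rw [h1, wordPoly, Fin.sum_univ_castSucc, mul_add, Finset.mul_sum, map_mul]
  have h3 : ∀ i : Fin n, X * (C (c i.castSucc) * X ^ ((i.castSucc : Fin (n + 1)) : ℕ)) =
      C (c i.castSucc) * X ^ ((i : ℕ) + 1) := fun i => by
    rw [Fin.val_castSucc, pow_succ]; ring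
  rw [Finset.sum_congr rfl fun i _ => h3 i, Fin.val_last]
  ring

/-- The code of the multiples of `g`. -/
def polyCode (n : ℕ) (g : F[X]) : Submodule F (Fin n → F) where
  carrier := {c | g ∣ wordPoly c}
  add_mem' {a b} ha hb := by
    have : wordPoly (a + b) = wordPoly a + wordPoly b := by
      simp [wordPoly, add_mul, Finset.sum_add_distrib]
    change g ∣ wordPoly (a + b)
    rw [this]
    exact dvd_add ha hb
  zero_mem' := by simp [wordPoly]
  smul_mem' r a ha := by
    have : wordPoly (r • a) = C r * wordPoly a := by
      simp [wordPoly, Finset.mul_sum, mul_assoc]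
    change g ∣ wordPoly (r • a)
    rw [this]
    exact ha.mul_left _

lemma isConstacyclic_polyCode {α : F} {g : F[X]} (hn : 0 < n) (hg : g ∣ X ^ n - C α) :
    IsConstacyclic α (polyCode n g) := by
  obtain ⟨n, rfl⟩ := Nat.exists_eq_succ_of_ne_zero hn.ne'
  intro c hc
  change g ∣ wordPoly (constacyclicShift α c)
  rw [wordPoly_constacyclicShift]
  exact dvd_sub (Dvd.dvd.mul_left hc _) (hg.mul_left _)

lemma mem_rootExponents_iff {r : ℕ} (hr : 0 < r) (hn : 0 < n) {x : ZMod (r * n)} :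
    x ∈ rootExponents r n ↔ ∃ y : ZMod (r * n), x = 1 + r * y := by
  have : NeZero (r * n) := ⟨(Nat.mul_pos hr hn).ne'⟩
  constructor
  · rintro ⟨j, -, rfl⟩
    exact ⟨j, rfl⟩
  · rintro ⟨y, rfl⟩
    refine ⟨y.val % n, Nat.mod_lt _ hn, ?_⟩
    have h1 : (r : ZMod (r * n)) * ((y.val : ℕ) : ZMod (r * n)) =
        r * ((y.val % n : ℕ) : ZMod (r * n)) := by
      have h0 : (r : ZMod (r * n)) * n = 0 := by
        rw [← Nat.cast_mul, ZMod.natCast_self]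
      conv_lhs => rw [← Nat.mod_add_div y.val n]
      push_cast
      linear_combination ((y.val / n : ℕ) : ZMod (r * n)) * h0
    rw [← h1, ZMod.natCast_zmod_val]

/-- A set of root exponents that is closed under multiplication by the cardinality of `F` is the
defining set of a constacyclic code. -/
theorem exists_isConstacyclicWithDefiningSet [Fintype F] {r : ℕ} (hr : 0 < r) (hn : 0 < n)
    {α : F} {δ : K} (hδ : IsPrimitiveRoot δ (r * n)) (hδα : δ ^ n = algebraMap F K α)
    {T : Set (ZMod (r * n))} (hT : T ⊆ rootExponents r n)
    (hTQ : ∀ x ∈ T, x * (Fintype.card F : ZMod (r * n)) ∈ T) :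
    ∃ 𝒞 : Submodule F (Fin n → F), IsConstacyclicWithDefiningSet r n α δ 𝒞 T := by
  classical
  have : NeZero (r * n) := ⟨(Nat.mul_pos hr hn).ne'⟩
  obtain ⟨p, hp⟩ := CharP.exists F
  obtain ⟨k, hpp, hk⟩ := FiniteField.card F p
  have := Fact.mk hpp
  have : CharP K p := charP_of_injective_algebraMap (algebraMap F K).injective p
  set τ : K →+* K := iterateFrobenius K p k with hτdef
  have hτx : ∀ x, τ x = x ^ Fintype.card F := fun x => by
    rw [hτdef, iterateFrobenius_def, hk]
  have hpow : ∀ a b : ℕ, (a : ZMod (r * n)) = b → δ ^ a = δ ^ b := by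
    intro a b h
    have := (ZMod.natCast_eq_natCast_iff a b (r * n)).1 h
    exact pow_eq_pow_of_modEq this hδ.pow_eq_one
  set R : Finset K := T.toFinset.image fun i => δ ^ i.val with hR
  have hRmem : ∀ x, x ∈ R ↔ ∃ i ∈ T, δ ^ i.val = x := fun x => by simp [hR]
  -- Closure of T under multiplication by |F| makes Frobenius permute the chosen roots, so the
  -- coefficients of their product lie in F.
  have hτR : R.image τ = R := by
    refine Finset.eq_of_subset_of_card_le (fun x hx => ?_)
      (by rw [Finset.card_image_of_injective _ τ.injective])
    obtain ⟨y, hy, rfl⟩ := Finset.mem_image.1 hx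
    obtain ⟨i, hi, rfl⟩ := (hRmem y).1 hy
    refine (hRmem _).2 ⟨_, hTQ i hi, ?_⟩
    rw [hτx, ← pow_mul]
    apply hpow
    rw [ZMod.natCast_zmod_val, Nat.cast_mul, ZMod.natCast_zmod_val]
  set G : K[X] := ∏ x ∈ R, (X - C x) with hG
  have hGmonic : G.Monic := monic_prod_of_monic _ _ fun x _ => monic_X_sub_C x
  have hGτ : G.map τ = G := by
    rw [hG, Polynomial.map_prod]
    conv_rhs => rw [← hτR]
    rw [Finset.prod_image fun x _ y _ h => τ.injective h]
    simp
  have hGlift : G ∈ lifts (algebraMap F K) := by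
    rw [lifts_iff_coeff_lifts]
    intro l
    refine exists_algebraMap_eq_of_pow_card ?_
    rw [← hτx, ← coeff_map, hGτ]
  obtain ⟨g, hgG, -, hgmonic⟩ := lifts_and_degree_eq_and_monic hGlift hGmonic
  have hpoly : (X ^ n - C (algebraMap F K α) : K[X]) ≠ 0 := X_pow_sub_C_ne_zero hn _
  have hdvd : g ∣ X ^ n - C α := by
    rw [← map_dvd_map' (algebraMap F K), hgG, Polynomial.map_sub, Polynomial.map_pow, map_X, map_C]
    refine (Multiset.prod_X_sub_C_dvd_iff_le_roots hpoly R.val).2 ?_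
    rw [Multiset.le_iff_subset R.nodup]
    intro x hx
    obtain ⟨i, hi, rfl⟩ := (hRmem x).1 hx
    rw [mem_roots hpoly, IsRoot.def]
    obtain ⟨j, -, hj⟩ := hT hi
    have h1 : δ ^ i.val = δ ^ (1 + r * j) := hpow _ _ (by
      rw [ZMod.natCast_zmod_val, hj]; push_cast; ring)
    have h3 : (δ ^ i.val) ^ n = δ ^ n := by
      rw [h1, ← pow_mul, add_mul, one_mul, pow_add, mul_right_comm, pow_mul δ (r * n),
        hδ.pow_eq_one, one_pow, mul_one]
    simp [h3, hδα]
  refine ⟨polyCode n g, isConstacyclic_polyCode hn hdvd, g, ⟨hgmonic, hdvd, fun c => Iff.rfl⟩, ?_⟩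
  have hroot : ∀ i : ZMod (r * n), aeval (δ ^ i.val) g = 0 ↔ i ∈ T := by
    intro i
    rw [aeval_def, ← eval_map, hgG, hG, eval_prod, Finset.prod_eq_zero_iff]
    constructor
    · rintro ⟨x, hx, hx0⟩
      obtain ⟨i', hi', rfl⟩ := (hRmem x).1 hx
      rw [eval_sub, eval_X, eval_C, sub_eq_zero] at hx0
      have := hδ.pow_inj (ZMod.val_lt i) (ZMod.val_lt i') hx0
      rwa [ZMod.val_injective _ this]
    · intro hi
      exact ⟨_, (hRmem _).2 ⟨i, hi, rfl⟩, by simp⟩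
  ext i
  simp only [definingSet, Set.mem_ofPred_eq, hroot]
  exact ⟨fun h => h.2, fun h => ⟨hT h, h⟩⟩

end constacyclic

/-! ### The theorem for q = 10t + 3 -/

theorem mainTheorem4 {F K : Type*} [Field F] [Fintype F] [Field K] [Algebra F K]
    (q n lam : ℕ) (hF : Fintype.card F = q ^ 2) (hq : q ≡ 3 [MOD 10])
    (hn : 10 * n = q ^ 2 + 1) (hlam : 1 ≤ lam) (hlam' : 10 * lam ≤ q - 3)
    (α : F) (hα : IsPrimitiveRoot α (q + 1))
    (δ : K) (hδ : IsPrimitiveRoot δ ((q + 1) * n)) (hδα : δ ^ n = algebraMap F K α)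
    (T : Set (ZMod ((q + 1) * n)))
    (hT : T = ⋃ j ∈ Set.Icc (0 : ℕ) (4 * (q - 3) / 10 + lam),
      cyclotomicCoset (q ^ 2) ((q + 1) * n)
        ((((q ^ 2 + 1) / 2 : ℕ) : ZMod ((q + 1) * n)) -
          ((q + 1 : ℕ) : ZMod ((q + 1) * n)) * (j : ZMod ((q + 1) * n)))) :
    (∃ 𝒞 : Submodule F (Fin n → F), IsConstacyclicWithDefiningSet (q + 1) n α δ 𝒞 T) ∧
    ∀ 𝒞 : Submodule F (Fin n → F), IsConstacyclicWithDefiningSet (q + 1) n α δ 𝒞 T →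
      ∃ k d : ℕ,
        (k : ℚ) = n - 8 / 5 * ((q : ℚ) - 3) - 4 * lam + 7 ∧
        (d : ℚ) = 4 / 5 * ((q : ℚ) - 3) + 2 * lam + 2 ∧
        ExistsEAQECC q n k d 9 ∧
        (n : ℤ) + 9 - k = 2 * ((d : ℤ) - 1) ∧
        (q ≠ 13 → 2 * d ≤ n + 2) := by
  obtain ⟨t, rfl⟩ : ∃ t, q = 10 * t + 3 := ⟨q / 10, by unfold Nat.ModEq at hq; omega⟩
  have hn' : n = 10 * t ^ 2 + 6 * t + 1 := by nlinarith
  have hlt : lam ≤ t := by omega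
  have ht : 1 ≤ t := hlam.trans hlt
  have hn0 : 0 < n := by omega
  set m := 4 * t + lam with hm
  have hsq : t ≤ t ^ 2 := by nlinarith
  refine ⟨?_, fun _ _ => ⟨n + 7 - 4 * m, 2 * m + 2, ?_, ?_, ?_, ?_, ?_⟩⟩
  · refine exists_isConstacyclicWithDefiningSet (Nat.succ_pos _) hn0 hδ hδα ?_ ?_
    · rw [hT]
      refine Set.iUnion₂_subset fun j _ => ?_
      rintro _ ⟨l, rfl⟩
      rw [mem_rootExponents_iff (Nat.succ_pos _) hn0]
      induction l with
      | zero =>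
        -- This exhibits s as 1 + r(5t + 1). Multiplication by q² preserves the class of 1 modulo r
        -- because q² - 1 = r(10t + 2), which gives the witness in the inductive step.
        have h1 : ((10 * t + 3) ^ 2 + 1) / 2 = 1 + (10 * t + 3 + 1) * (5 * t + 1) := by
          have : (10 * t + 3) ^ 2 + 1 = 2 * (1 + (10 * t + 3 + 1) * (5 * t + 1)) := by ring
          omega
        refine ⟨5 * t + 1 - j, ?_⟩
        rw [h1]
        push_cast
        ring
      | succ l ih =>
        obtain ⟨y, hy⟩ := ih
        refine ⟨y + (10 * t + 2) + (10 * t + 4) * (10 * t + 2) * y, ?_⟩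
        rw [pow_succ _ l, ← mul_assoc, hy]
        push_cast
        ring
    · rw [hT, hF]
      intro x hx
      rw [Set.mem_iUnion₂] at hx ⊢
      obtain ⟨j, hj, l, rfl⟩ := hx
      exact ⟨j, hj, l + 1, by rw [pow_succ _ l, mul_assoc]⟩
  · have : 4 * m ≤ n + 7 := by nlinarith
    rw [Nat.cast_sub this, hm]
    push_cast
    ring
  · rw [hm]
    push_cast
    ring
  · refine existsEAQECC_of_fourierCode hF (by rw [Nat.odd_iff]; omega)
      (hδ.pow (Nat.mul_pos (Nat.succ_pos _) hn0) rfl) ⟨10, by rw [← hn]; ring⟩ ?_ ?_ ?_ ?_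
    · nlinarith
    · rw [hn']
      exact card_selfPairedFreq ht (by omega) (by omega)
    · have : 4 * m ≤ n + 7 := by nlinarith
      omega
    · have : 4 * m + 1 ≤ n + 7 := by nlinarith
      omega
  · have : 4 * m ≤ n + 7 := by nlinarith
    omega
  · intro h13
    -- Excluding q = 13 excludes t = 1; from t = 2 on, 2d ≤ 20t + 4 ≤ n + 2.
    have ht2 : 2 ≤ t := by omega
    nlinarith
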